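/- Let $H$ be a real separable Hilbert space, and assume the following. (i) $A:D(A)\subset H\to H$ is the infinitesimal generator of a strongly continuous semigroup $(e^{tA})_{t\ge 0}$. (ii) $Q$ is a nonnegative self-adjoint bounded operator on $H$ with $\operatorname{Ker}Q=\{0\}$, and for every $t>0$ the operator $Q_t=\int_0^t e^{sA}Qe^{sA^*}\,ds$ is of trace class. (iii) $e^{tA}(H)\subset Q_t^{1/2}(H)$ for every $t>0$. (iv) With $\Lambda(t)=Q_t^{-1/2}e^{tA}$, there are $\delta\in(0,1)$ and $C_\delta>0$ such that $\|\Lambda(t)\|_{\mathcal L(H)}\le C_\delta t^{-\delta}$ for all $t>0$. (v) $u_0:H\to\mathbb R$ and $B:H\to H$ are bounded and Borel measurable. For $t\ge 0$ and bounded measurable $f:H\to\mathbb R$ put $(S_tf)(x)=\int_H f(e^{tA}x+y)\,N_{Q_t}(dy)$, where $N_{Q_t}$ is the centred Gaussian measure on $H$ with covariance operator $Q_t$. Let $C_b^1(H)$ be the space of bounded Fréchet differentiable functions $f:H\to\mathbb R$ with bounded derivative $Df$. Define the iteration $$v^0(t,x)=(S_tu_0)(x),\qquad v^{n+1}(t,x)=\int_0^t\big(S_{t-s}\langle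 B,Dv^n(s)\rangle\big)(x)\,ds,\qquad t\ge 0,\ x\in H.$$ Then the iteration is well defined: for all $n\ge 0$ and $t>0$ one has $v^n(t)\in C_b^1(H)$, and $s\mapsto (S_{t-s}\langle B,Dv^n(s)\rangle)(x)$ is integrable on $(0,t)$ for every $x\in H$. Moreover, the series $u=\sum_{n\ge 0}v^n$ converges uniformly on $[0,T]\times H$ for every $T>0$; for every $t>0$ the function $u(t)$ has a continuous Fréchet derivative; and for every $T>0$ the limit $u$ has the following properties. (0) $u(0,x)=u_0(x)$ for all $x\in H$. (a) $u$ is bounded on $[0,T]\times H$, and $u(t)\in C_b^1(H)$ for every $t\in(0,T]$. (b) $t\mapsto\|Du(t)\|_\infty=\sup_{x\in H}\|Du(t,x)\|$ is integrable on $(0,T]$, that is, it is measurable and $\int_0^T\|Du(t)\|_\infty\,dt<\infty$. (c) For all $t\in(0,T]$ and $x\in H$ the function $s\mapsto (S_{t-s}\langle B,Du(s)\rangle)(x)$ is integrable on $(0,t)$, and $$u(t,x)=(S_tu_0)(x)+\int_0^t\big(S_{t-s}\langle B,Du(s)\rangle\big)(x)\,ds .$$ Finally, $u$ is the only such solution: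 for every $T>0$, every function $w:[0,T]\times H\to\mathbb R$ with the properties (0), (a), (b), (c) coincides with $u$ on $[0,T]\times H$. In particular, $u$ is the unique function on $[0,\infty)\times H$ that has these properties for all $T>0$. -/

import Mathlib

open MeasureTheory ProbabilityTheory Filter Topology Set

namespace MildKolmogorov

variable {H : Type*} [NormedAddCommGroup H] [InnerProductSpace ℝ H] [CompleteSpace H]

/-- A strongly continuous semigroup `(S t)_{t ≥ 0}` of bounded operators on `H`.  The values of `S`
at negative times are irrelevant. -/
structure C0Semigroup (H : Type*) [NormedAddCommGroup H] [InnerProductSpace ℝ H] where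
  /-- the operator at time `t` -/
  op : ℝ → H →L[ℝ] H
  op_zero : op 0 = ContinuousLinearMap.id ℝ H
  op_add : ∀ s t : ℝ, 0 ≤ s → 0 ≤ t → op (s + t) = (op s).comp (op t)
  continuousOn_orbit : ∀ x : H, ContinuousOn (fun t => op t x) (Ici 0)

/-- The (unbounded) operator `A` is the infinitesimal generator of `S`: `x ∈ D(A)` and `A x = y`
if and only if `(S t x - x) / t → y` as `t ↓ 0`. -/
def C0Semigroup.IsGenerator (S : C0Semigroup H) (A : H →ₗ.[ℝ] H) : Prop :=
  ∀ x y : H, (x, y) ∈ A.graph ↔ Tendsto (fun t : ℝ => t⁻¹ • (S.op t x - x)) (𝓝[>] 0) (𝓝 y)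

theorem C0Semigroup.exists_bound (S : C0Semigroup H) (t : ℝ) :
    ∃ M : ℝ, 0 ≤ M ∧ ∀ s ∈ Ioc 0 t, ‖S.op s‖ ≤ M := by
  have h := banach_steinhaus (g := fun s : Icc (0 : ℝ) t => S.op s) (fun x => by
    obtain ⟨C, hC⟩ := isCompact_Icc.exists_bound_of_continuousOn
      ((S.continuousOn_orbit x).mono (Icc_subset_Ici_self : Icc (0 : ℝ) t ⊆ Ici 0))
    exact ⟨C, fun s => hC s s.2⟩)
  obtain ⟨C, hC⟩ := h
  exact ⟨max C 0, le_max_right _ _,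
    fun s hs => (hC ⟨s, hs.1.le, hs.2⟩).trans (le_max_left _ _)⟩

/-- In a separable Hilbert space a weakly measurable function is strongly measurable. -/
theorem aestronglyMeasurable_of_inner [SecondCountableTopology H] {α : Type*}
    [MeasurableSpace α] {μ : Measure α} {f : α → H}
    (hf : ∀ y : H, AEStronglyMeasurable (fun a => (inner ℝ y (f a) : ℝ)) μ) :
    AEStronglyMeasurable f μ := by
  obtain ⟨w, b, -⟩ := exists_hilbertBasis ℝ H
  have : Countable w := by
    refine Pairwise.countable_of_isOpen_disjoint (s := fun i => Metric.ball (b i) (1 / 2)) ?_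
      (fun i => Metric.isOpen_ball) (fun i => ⟨b i, Metric.mem_ball_self (by norm_num)⟩)
    intro i j hij
    refine Metric.ball_disjoint_ball ?_
    have h1 : ‖b i - b j‖ * ‖b i - b j‖ = 2 := by
      rw [norm_sub_mul_self_real, b.orthonormal.2 hij, b.orthonormal.1, b.orthonormal.1]
      norm_num
    rw [dist_eq_norm]
    nlinarith [norm_nonneg (b i - b j)]
  refine aestronglyMeasurable_of_tendsto_ae (u := (atTop : Filter (Finset w)))
    (f := fun F a => ∑ i ∈ F, (inner ℝ (b i) (f a) : ℝ) • b i) ?_ ?_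
  · intro F
    exact Finset.aestronglyMeasurable_fun_sum _ (fun i _ => (hf (b i)).smul_const (b i))
  · refine Eventually.of_forall fun a => ?_
    have := b.hasSum_repr (f a)
    simpa [HasSum, b.repr_apply_apply] using this

theorem norm_cov_le (S : C0Semigroup H) (Q : H →L[ℝ] H) {M s : ℝ} (hM0 : 0 ≤ M)
    (hM : ‖S.op s‖ ≤ M) (x : H) :
    ‖S.op s (Q ((S.op s).adjoint x))‖ ≤ M * (‖Q‖ * (M * ‖x‖)) := by
  have h1 : ‖(S.op s).adjoint x‖ ≤ M * ‖x‖ :=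
    ((S.op s).adjoint.le_opNorm x).trans (by rw [LinearIsometryEquiv.norm_map]; gcongr)
  calc _ ≤ ‖S.op s‖ * (‖Q‖ * ‖(S.op s).adjoint x‖) :=
        ((S.op s).le_opNorm _).trans (by gcongr; exact Q.le_opNorm _)
    _ ≤ _ := by gcongr

theorem integrableOn_cov [SecondCountableTopology H] (S : C0Semigroup H) (Q : H →L[ℝ] H)
    (t : ℝ) (x : H) :
    IntegrableOn (fun s => S.op s (Q ((S.op s).adjoint x))) (Ioc 0 t) := by
  obtain ⟨M, hM0, hM⟩ := S.exists_bound t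
  have hcont : ∀ z y : H,
      AEStronglyMeasurable (fun s => (inner ℝ z (S.op s y) : ℝ)) (volume.restrict (Ioc 0 t)) := by
    intro z y
    refine ContinuousOn.aestronglyMeasurable ?_ measurableSet_Ioc
    exact continuousOn_const.inner
      ((S.continuousOn_orbit y).mono fun s hs => hs.1.le)
  have hadj : ∀ y : H,
      AEStronglyMeasurable (fun s => (S.op s).adjoint y) (volume.restrict (Ioc 0 t)) := by
    intro y
    refine aestronglyMeasurable_of_inner fun z => ?_
    refine (hcont y z).congr (Eventually.of_forall fun s => ?_)
    simp [ContinuousLinearMap.adjoint_inner_right, real_inner_comm]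
  refine Integrable.of_bound ?_ (M * (‖Q‖ * (M * ‖x‖))) ?_
  · refine aestronglyMeasurable_of_inner fun z => ?_
    have h := (hadj z).inner (𝕜 := ℝ) (Q.continuous.comp_aestronglyMeasurable (hadj x))
    refine h.congr (Eventually.of_forall fun s => ?_)
    simp [ContinuousLinearMap.adjoint_inner_left]
  · exact (ae_restrict_iff' measurableSet_Ioc).2
      (Eventually.of_forall fun s hs => norm_cov_le S Q hM0 (hM s hs) x)

/-- The covariance operator `Q_t = ∫₀ᵗ e^{sA} Q e^{sA*} ds` for `t ≥ 0`, the integral being taken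
in the strong sense, that is, `Q_t x = ∫₀ᵗ e^{sA} Q e^{sA*} x ds` for every `x`. -/
noncomputable def covOp [SecondCountableTopology H] (S : C0Semigroup H) (Q : H →L[ℝ] H) (t : ℝ) :
    H →L[ℝ] H :=
  LinearMap.mkContinuousOfExistsBound
    { toFun := fun x => ∫ s in Ioc 0 t, S.op s (Q ((S.op s).adjoint x))
      map_add' := fun x y => by
        simp only [map_add]
        exact integral_add (integrableOn_cov S Q t x) (integrableOn_cov S Q t y)
      map_smul' := fun c x => by
        simp only [map_smul, RingHom.id_apply]
        exact integral_smul c _ }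
    (by
      obtain ⟨M, hM0, hM⟩ := S.exists_bound t
      refine ⟨M * (‖Q‖ * M) * volume.real (Ioc 0 t), fun x => ?_⟩
      refine (norm_setIntegral_le_of_norm_le_const (C := M * (‖Q‖ * (M * ‖x‖))) (by simp)
        (fun s hs => norm_cov_le S Q hM0 (hM s hs) x)).trans (le_of_eq ?_)
      ring)

/-- A nonnegative self-adjoint operator `C` is of trace class: `∑ᵢ ⟨C eᵢ, eᵢ⟩ < ∞` for an
orthonormal basis `(eᵢ)` of `H` (for nonnegative `C` the sum does not depend on the basis). -/
def HasFiniteTrace (C : H →L[ℝ] H) : Prop :=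
  ∃ (w : Set H) (b : HilbertBasis w ℝ H), Summable fun i => (inner ℝ (C (b i)) (b i) : ℝ)

open Classical in
/-- The square root `C^{1/2}` of a nonnegative self-adjoint operator `C`, i.e. the (unique)
nonnegative self-adjoint operator `R` with `R² = C`. -/
noncomputable def sqrtOp (C : H →L[ℝ] H) : H →L[ℝ] H :=
  if h : ∃ R : H →L[ℝ] H, R.IsPositive ∧ R.comp R = C then h.choose else 0

/-- `C^{-1/2} y` for `y` in the range of `C^{1/2}`, where `C^{1/2}` is injective. -/
noncomputable def invSqrt (C : H →L[ℝ] H) : H → H :=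
  Function.invFun (sqrtOp C)

/-- `Λ(t) = Q_t^{-1/2} e^{tA}`. -/
noncomputable def Lam [SecondCountableTopology H] (S : C0Semigroup H) (Q : H →L[ℝ] H) (t : ℝ)
    (h : H) : H :=
  invSqrt (covOp S Q t) (S.op t h)

variable [MeasurableSpace H] [BorelSpace H] [SecondCountableTopology H]

open Classical in
/-- `N_C`, the (unique) centred Gaussian probability measure on `H` with covariance operator `C`;
it exists for every nonnegative self-adjoint operator `C` of trace class. -/
noncomputable def centredGaussian (C : H →L[ℝ] H) : Measure H :=
  if h : ∃ μ : Measure H, IsGaussian μ ∧ ∫ y, y ∂μ = 0 ∧ covarianceOperator μ = C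
  then h.choose else 0

/-- The Ornstein–Uhlenbeck transition semigroup
`(S_t f)(x) = ∫ f (e^{tA} x + y) N_{Q_t}(dy)`. -/
noncomputable def ouSemigroup (S : C0Semigroup H) (Q : H →L[ℝ] H) (t : ℝ) (f : H → ℝ) (x : H) : ℝ :=
  ∫ y, f (S.op t x + y) ∂(centredGaussian (covOp S Q t))

/-- `⟨B, Dv⟩`, the function `x ↦ ⟨B(x), Dv(x)⟩`, where the Fréchet derivative `Dv(x)` is
regarded as an element of the dual of `H`. -/
noncomputable def drift (B : H → H) (v : H → ℝ) (x : H) : ℝ := fderiv ℝ v x (B x)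

/-- `‖Dv‖_∞ = sup_x ‖Dv(x)‖` (meaningful for `v` with bounded derivative). -/
noncomputable def supNormD (v : H → ℝ) : ℝ := ⨆ x, ‖fderiv ℝ v x‖

/-- `f ∈ C_b^1(H)`: `f` is Fréchet differentiable on `H`, bounded, with bounded derivative. -/
def IsCb1 (f : H → ℝ) : Prop :=
  Differentiable ℝ f ∧ (∃ M : ℝ, ∀ x, |f x| ≤ M) ∧ ∃ M : ℝ, ∀ x, ‖fderiv ℝ f x‖ ≤ M

/-- The integrand `s ↦ (S_{t-s} ⟨B, Dw(s)⟩)(x)` of the mild formulation. -/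
noncomputable def mildIntegrand (S : C0Semigroup H) (Q : H →L[ℝ] H) (B : H → H)
    (w : ℝ → H → ℝ) (t : ℝ) (x : H) (s : ℝ) : ℝ :=
  ouSemigroup S Q (t - s) (drift B (w s)) x

/-- The iteration `v⁰(t) = S_t u₀`, `vⁿ⁺¹(t,x) = ∫₀ᵗ (S_{t-s} ⟨B, Dvⁿ(s)⟩)(x) ds`. -/
noncomputable def iter (S : C0Semigroup H) (Q : H →L[ℝ] H) (B : H → H) (u₀ : H → ℝ) :
    ℕ → ℝ → H → ℝ
  | 0 => fun t x => ouSemigroup S Q t u₀ x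
  | n + 1 => fun t x => ∫ s in (0 : ℝ)..t, mildIntegrand S Q B (iter S Q B u₀ n) t x s

/-- `u` is a solution on `[0,T]` of the Kolmogorov equation
`∂_t u = ½ Tr(Q D²u) + ⟨A x + B(x), Du⟩`, `u(0) = u₀`, in the mild sense. -/
structure IsMildSolution (S : C0Semigroup H) (Q : H →L[ℝ] H) (B : H → H) (u₀ : H → ℝ) (T : ℝ)
    (u : ℝ → H → ℝ) : Prop where
  initial : ∀ x, u 0 x = u₀ x
  bounded : ∃ M : ℝ, ∀ t ∈ Icc 0 T, ∀ x, |u t x| ≤ M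
  cb1 : ∀ t ∈ Ioc 0 T, IsCb1 (u t)
  integrable_supNormD : IntegrableOn (fun t => supNormD (u t)) (Ioc 0 T)
  integrable_mild : ∀ t ∈ Ioc 0 T, ∀ x,
    IntervalIntegrable (mildIntegrand S Q B u t x) volume 0 t
  mild : ∀ t ∈ Ioc 0 T, ∀ x,
    u t x = ouSemigroup S Q t u₀ x + ∫ s in (0 : ℝ)..t, mildIntegrand S Q B u t x s

end MildKolmogorov

open MildKolmogorov

/-! The theorem rests on the smoothing estimate `‖D S_t f‖_∞ ≤ C t^{-δ} ‖f‖_∞` for bounded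
measurable `f` (`IsSmoothing.contDiff_ouSemigroup`). Since `e^{tA} = Q_t^{1/2} Λ(t)`, one has `S_t f
= g ∘ Λ(t)` with `g(z) = ∫ f(Q_t^{1/2} z + y) N_{Q_t}(dy)`. The Cameron–Martin formula
(`integral_shift_eq`) turns a shift of `z` by `h` into the density `exp(W h - ‖h‖²/2)`, where `W` is
an isonormal Gaussian process. This density differs from `1 + W h` by at most `‖h‖²` in `L¹`, so `g`
is `C¹` with `‖Dg‖ ≤ sup |f|`, however rough `f` is (`contDiff_integral_centredGaussian`).

Existence is a Picard iteration. If `‖Dv(s)‖_∞ ≤ m(s)`, one step bounds the new derivative by `K C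
∫₀ᵗ (t-s)^{-δ} m(s) ds`, where `K` bounds `B` (`IsSmoothing.isRegular_integral`). Measured against
the weight `s^{-δ} e^{ls}`, this Volterra operator has arbitrarily small norm for large `l`
(`exists_weight`). Hence the derivatives decay like `2^{-n}` times the weight, the series converges
together with its derivatives, and the mild equation passes to the sum.

For uniqueness, `N(t) = ‖D(w-u)(t)‖_∞` satisfies the homogeneous Volterra inequality
(`IsSmoothing.enorm_fderiv_sub_le`). A competitor `w` is only known to have an integrable derivative
norm, so the inequality is iterated in `L¹` with weight `e^{-lt}` (`ae_eq_zero_of_le_volterra`).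
Then `N = 0` almost everywhere, and the two mild equations have the same right-hand side.

Two foundations come first: a construction of `N_C` that carries an isonormal process along, and the
measurability of `t ↦ N_{Q_t}`, obtained from its characteristic functions. -/

namespace MildKolmogorov

open scoped ENNReal NNReal BoundedContinuousFunction

/-! ### Square roots of positive operators -/

/-- The closed form shows that the Catalan generating function converges absolutely at the boundary
point `1/4` of its disc, with value at most `2`. The boundary is needed because `1 - C` may have
norm exactly `1`. -/
theorem sum_catalan_div_four_pow (N : ℕ) :
    ∑ n ∈ Finset.range N, (catalan n : ℝ) / 4 ^ n = 2 - 2 * (N.centralBinom / 4 ^ N) := by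
  induction N with
  | zero => simp
  | succ N ih =>
    rw [Finset.sum_range_succ, ih]
    have h1 : ((N : ℝ) + 1) * catalan N = N.centralBinom := by
      exact_mod_cast succ_mul_catalan_eq_centralBinom N
    have h2 : ((N : ℝ) + 1) * (N + 1).centralBinom = 2 * (2 * N + 1) * N.centralBinom := by
      exact_mod_cast Nat.succ_mul_centralBinom_succ N
    have hN : (N : ℝ) + 1 ≠ 0 := by positivity
    rw [← h1] at h2 ⊢
    have h3 : ((N + 1).centralBinom : ℝ) = 2 * (2 * N + 1) * catalan N := by
      apply mul_left_cancel₀ hN; rw [h2]; ring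
    rw [h3, pow_succ]
    field_simp
    ring

theorem summable_catalan_div_four_pow : Summable fun n : ℕ => (catalan n : ℝ) / 4 ^ n :=
  summable_of_sum_range_le (c := 2) (fun n => by positivity) fun N => by
    rw [sum_catalan_div_four_pow]
    have : (0 : ℝ) ≤ N.centralBinom / 4 ^ N := by positivity
    linarith

theorem tsum_catalan_div_four_pow_le : ∑' n : ℕ, (catalan n : ℝ) / 4 ^ n ≤ 2 :=
  summable_catalan_div_four_pow.tsum_le_of_sum_range_le fun N => by
    rw [sum_catalan_div_four_pow]
    have : (0 : ℝ) ≤ N.centralBinom / 4 ^ N := by positivity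
    linarith

section Sqrt

variable {H : Type*} [NormedAddCommGroup H] [InnerProductSpace ℝ H]

/-- Expand `0 ≤ ⟨C(x - Cx), x - Cx⟩` and use `⟨C(Cx), Cx⟩ ≤ ‖Cx‖²`. -/
theorem norm_apply_sq_le_inner {C : H →L[ℝ] H} (hC : C.IsPositive) (h1 : ‖C‖ ≤ 1) (x : H) :
    ‖C x‖ ^ 2 ≤ inner ℝ (C x) x := by
  have h := hC.inner_nonneg_left (x - C x)
  have h2 : inner ℝ (C (C x)) (C x) ≤ ‖C x‖ ^ 2 := by
    refine (real_inner_le_norm _ _).trans ?_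
    rw [sq]
    gcongr
    exact (C.le_opNorm _).trans (by nlinarith [norm_nonneg (C x)])
  simp only [map_sub, inner_sub_left, inner_sub_right] at h
  rw [hC.inner_left_eq_inner_right (C x) x, real_inner_self_eq_norm_sq] at h
  linarith

theorem norm_one_sub_le {C : H →L[ℝ] H} (hC : C.IsPositive) (h1 : ‖C‖ ≤ 1) : ‖1 - C‖ ≤ 1 := by
  refine ContinuousLinearMap.opNorm_le_bound _ zero_le_one fun x => ?_
  rw [one_mul, ← sq_le_sq₀ (norm_nonneg _) (norm_nonneg _)]
  have := norm_apply_sq_le_inner hC h1 x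
  have h0 := hC.inner_nonneg_left x
  simp only [sub_apply, one_apply_eq_self]
  rw [@norm_sub_sq_real, real_inner_comm]
  linarith

variable [CompleteSpace H]

/-- With `X = 1 - C`, the root is the power series of `√(1 - X)`, written as `1 - Y` with `Y = X Z /
2` and `Z = ∑ catalan n (X/4)ⁿ`. The Catalan recursion gives `Z = 1 + X Z²/4`, hence `Y² = 2Y - X`
and `(1 - Y)² = 1 - X`. Positivity follows from `‖Y‖ ≤ 1`, since `‖Z‖ ≤ 2`. -/
theorem exists_sqrt_of_norm_le_one {C : H →L[ℝ] H} (hC : C.IsPositive) (h1 : ‖C‖ ≤ 1) :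
    ∃ R : H →L[ℝ] H, R.IsPositive ∧ R.comp R = C := by
  set X : H →L[ℝ] H := 1 - C with hX
  have hXn : ‖X‖ ≤ 1 := norm_one_sub_le hC h1
  have hXs : IsSelfAdjoint X := (IsSelfAdjoint.one _).sub hC.isSelfAdjoint
  set a : ℕ → H →L[ℝ] H := fun n => ((catalan n : ℝ) / 4 ^ n) • X ^ n with ha
  have hXp : ∀ n : ℕ, ‖X ^ n‖ ≤ 1 := by
    intro n
    induction n with
    | zero => exact ContinuousLinearMap.norm_id_le
    | succ n ih =>
      rw [pow_succ]
      exact (norm_mul_le _ _).trans (mul_le_one₀ ih (norm_nonneg _) hXn)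
  have han : ∀ n, ‖a n‖ ≤ (catalan n : ℝ) / 4 ^ n := fun n => by
    rw [ha, norm_smul, Real.norm_of_nonneg (by positivity)]
    exact mul_le_of_le_one_right (by positivity) (hXp n)
  have hs : Summable fun n => ‖a n‖ :=
    Summable.of_nonneg_of_le (fun _ => norm_nonneg _) han summable_catalan_div_four_pow
  have hs' : Summable a := hs.of_norm
  set Z := ∑' n, a n with hZ
  have hZn : ‖Z‖ ≤ 2 := (tsum_of_norm_bounded summable_catalan_div_four_pow.hasSum han).trans
    tsum_catalan_div_four_pow_le
  have hZs : IsSelfAdjoint Z := by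
    rw [IsSelfAdjoint, hZ, tsum_star]
    refine tsum_congr fun n => ?_
    exact (IsSelfAdjoint.smul (IsSelfAdjoint.all _) (hXs.pow n)).star_eq
  have hZX : Commute X Z := by
    refine Commute.tsum_right X fun n => ?_
    exact ((Commute.refl X).pow_right n).smul_right _
  -- The functional equation `c(x) = 1 + x c(x)²` of the Catalan series, at `x = X/4`: the Cauchy
  -- product of the series with itself has the next Catalan number as coefficient.
  have hZ2 : Z = 1 + (1 / 4 : ℝ) • (X * (Z * Z)) := by
    rw [hZ, tsum_mul_tsum_eq_tsum_sum_antidiagonal_of_summable_norm hs hs, hs'.tsum_eq_zero_add]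
    congr 1
    · simp [ha]
    · have hsum := (summable_norm_sum_mul_antidiagonal_of_summable_norm hs hs).of_norm
      rw [← hsum.tsum_mul_left, ← Summable.tsum_const_smul _ (hsum.mul_left X)]
      refine tsum_congr fun n => ?_
      have : ∑ kl ∈ Finset.HasAntidiagonal.antidiagonal n, a kl.1 * a kl.2
          = ((catalan (n + 1) : ℝ) / 4 ^ n) • X ^ n := by
        rw [catalan_succ', Nat.cast_sum, Finset.sum_div, Finset.sum_smul]
        refine Finset.sum_congr rfl fun kl hkl => ?_
        obtain rfl := Finset.HasAntidiagonal.mem_antidiagonal.1 hkl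
        simp only [ha, smul_mul_smul_comm, ← pow_add, Nat.cast_mul]
        congr 1
        rw [pow_add]
        field_simp
      rw [this, mul_smul_comm, smul_smul, ← pow_succ']
      simp only [ha]
      congr 1
      rw [pow_succ]; ring
  set Y : H →L[ℝ] H := (1 / 2 : ℝ) • (X * Z) with hY
  have hYn : ‖Y‖ ≤ 1 := by
    rw [hY, norm_smul]
    have : ‖X * Z‖ ≤ 1 * 2 := (norm_mul_le _ _).trans (by gcongr)
    norm_num
    linarith
  have hYs : IsSelfAdjoint Y := by
    refine IsSelfAdjoint.smul (IsSelfAdjoint.all _) ?_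
    exact (IsSelfAdjoint.commute_iff hXs hZs).1 hZX
  have hY2 : Y * Y = (2 : ℝ) • Y - X := by
    have e1 : Y * Y = X * ((1 / 4 : ℝ) • (X * (Z * Z))) := by
      rw [hY, smul_mul_smul_comm, mul_smul_comm]
      rw [show X * Z * (X * Z) = X * (X * (Z * Z)) by
        rw [mul_assoc, ← mul_assoc Z X Z, ← hZX.eq, mul_assoc]]
      norm_num
    have e2 : (1 / 4 : ℝ) • (X * (Z * Z)) = Z - 1 := by
      nth_rw 3 [hZ2]; simp
    rw [e1, e2, mul_sub, mul_one, hY, smul_smul]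
    norm_num
  refine ⟨1 - Y, ?_, ?_⟩
  · rw [ContinuousLinearMap.isPositive_iff']
    refine ⟨(IsSelfAdjoint.one _).sub hYs, fun x => ?_⟩
    simp only [sub_apply, one_apply_eq_self, inner_sub_left,
      real_inner_self_eq_norm_sq]
    have : inner ℝ (Y x) x ≤ ‖x‖ ^ 2 := by
      refine (real_inner_le_norm _ _).trans ?_
      rw [sq]
      gcongr
      exact (Y.le_opNorm x).trans (by nlinarith [norm_nonneg x])
    linarith
  · change (1 - Y) * (1 - Y) = C
    have : (1 - Y) * (1 - Y) = 1 - (2 : ℝ) • Y + Y * Y := by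
      rw [two_smul]; noncomm_ring
    rw [this, hY2, hX]; abel

theorem exists_sqrt {C : H →L[ℝ] H} (hC : C.IsPositive) :
    ∃ R : H →L[ℝ] H, R.IsPositive ∧ R.comp R = C := by
  by_cases h0 : ‖C‖ = 0
  · rw [norm_eq_zero] at h0
    exact ⟨0, ContinuousLinearMap.isPositive_zero, by simp [h0]⟩
  have hpos : 0 < ‖C‖ := lt_of_le_of_ne (norm_nonneg _) (Ne.symm h0)
  obtain ⟨R, hR, hR2⟩ := exists_sqrt_of_norm_le_one (C := ‖C‖⁻¹ • C)
    (hC.smul_of_nonneg (by positivity)) (by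
      rw [norm_smul, norm_inv, norm_norm, inv_mul_cancel₀ h0])
  refine ⟨√‖C‖ • R, hR.smul_of_nonneg (by positivity), ?_⟩
  rw [ContinuousLinearMap.smul_comp, ContinuousLinearMap.comp_smul, hR2, smul_smul, smul_smul,
    Real.mul_self_sqrt hpos.le, mul_inv_cancel₀ h0, one_smul]

/-- Existence rules out the default value `0`. The later arguments need no uniqueness of the root:
positivity and the square suffice. -/
theorem sqrtOp_isPositive {C : H →L[ℝ] H} (hC : C.IsPositive) : (sqrtOp C).IsPositive := by
  rw [sqrtOp, dif_pos (exists_sqrt hC)]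
  exact (exists_sqrt hC).choose_spec.1

theorem sqrtOp_comp_self {C : H →L[ℝ] H} (hC : C.IsPositive) :
    (sqrtOp C).comp (sqrtOp C) = C := by
  have h := (exists_sqrt hC).choose_spec.2
  rwa [sqrtOp, dif_pos (exists_sqrt hC)]

theorem sqrtOp_apply_sqrtOp {C : H →L[ℝ] H} (hC : C.IsPositive) (x : H) :
    sqrtOp C (sqrtOp C x) = C x :=
  congrArg (fun T : H →L[ℝ] H => T x) (sqrtOp_comp_self hC)

theorem inner_sqrtOp_sqrtOp {C : H →L[ℝ] H} (hC : C.IsPositive) (x y : H) :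
    inner ℝ (sqrtOp C x) (sqrtOp C y) = inner ℝ (C x) y := by
  rw [← (sqrtOp_isPositive hC).inner_left_eq_inner_right, sqrtOp_apply_sqrtOp hC]

theorem norm_sqrtOp_sq {C : H →L[ℝ] H} (hC : C.IsPositive) (x : H) :
    ‖sqrtOp C x‖ ^ 2 = inner ℝ (C x) x := by
  rw [← inner_sqrtOp_sqrtOp hC, real_inner_self_eq_norm_sq]

end Sqrt

/-! ### The isonormal Gaussian process -/

section Isonormal

variable {Ω : Type*} [MeasurableSpace Ω] {P : Measure Ω}

theorem integral_sq_Lp_two (f : Lp ℝ 2 P) : ∫ ω, f ω ^ 2 ∂P = ‖f‖ ^ 2 := by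
  rw [← real_inner_self_eq_norm_sq, L2.inner_def]
  exact integral_congr_ae (Eventually.of_forall fun ω => by simp [sq])

theorem charFun_map_Lp (f : Lp ℝ 2 P) (s : ℝ) :
    charFun (P.map f) s = ∫ ω, Complex.exp ((s * f ω : ℝ) * Complex.I) ∂P := by
  rw [charFun_apply_real, integral_map (Lp.memLp f).1.aemeasurable (by fun_prop)]
  push_cast
  rfl

/-- `f` is a centred Gaussian random variable with variance `‖f‖²`. -/
def IsCentredGaussian (f : Lp ℝ 2 P) : Prop := P.map f = gaussianReal 0 (‖f‖₊ ^ 2)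

theorem isCentredGaussian_of_hasGaussianLaw {f : Lp ℝ 2 P} (hf : HasGaussianLaw f P)
    (h0 : ∫ ω, f ω ∂P = 0) : IsCentredGaussian f := by
  rw [IsCentredGaussian, hf.map_eq_gaussianReal, h0]
  congr
  rw [variance_of_integral_eq_zero hf.aemeasurable h0, integral_sq_Lp_two]
  ext
  simp

variable [IsProbabilityMeasure P]

theorem integrable_Lp_two (f : Lp ℝ 2 P) : Integrable f P :=
  (Lp.memLp f).integrable (by norm_num)

theorem integral_abs_le_norm (f : Lp ℝ 2 P) : ∫ ω, |f ω| ∂P ≤ ‖f‖ := by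
  have h := eLpNorm_le_eLpNorm_of_exponent_le (μ := P) (p := 1) (q := 2) (by norm_num)
    (Lp.memLp f).1
  rw [Lp.norm_def]
  refine le_trans (le_of_eq ?_) (ENNReal.toReal_mono (Lp.memLp f).2.ne h)
  rw [eLpNorm_one_eq_lintegral_enorm, ← integral_norm_eq_lintegral_enorm (Lp.memLp f).1]
  rfl

theorem norm_cexp_sub_cexp_le (a b : ℝ) :
    ‖Complex.exp (a * Complex.I) - Complex.exp (b * Complex.I)‖ ≤ |a - b| := by
  have h : Complex.exp (a * Complex.I) - Complex.exp (b * Complex.I)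
      = Complex.exp (b * Complex.I) * (Complex.exp (Complex.I * ((a - b : ℝ) : ℂ)) - 1) := by
    rw [mul_sub, ← Complex.exp_add, mul_one]
    congr 2
    push_cast; ring
  rw [h, norm_mul, Complex.norm_exp_ofReal_mul_I, one_mul]
  exact Real.norm_exp_I_mul_ofReal_sub_one_le

theorem integrable_cexp_Lp (f : Lp ℝ 2 P) (s : ℝ) :
    Integrable (fun ω => Complex.exp ((s * f ω : ℝ) * Complex.I)) P := by
  refine Integrable.of_bound (C := 1) ?_ (Eventually.of_forall fun ω => ?_)
  · have h := (Lp.memLp f).1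
    exact (Continuous.comp_aestronglyMeasurable
      (g := fun x : ℝ => Complex.exp ((s * x : ℝ) * Complex.I)) (by fun_prop) h)
  · rw [Complex.norm_exp_ofReal_mul_I]

theorem continuous_integral_cexp (s : ℝ) :
    Continuous fun f : Lp ℝ 2 P => ∫ ω, Complex.exp ((s * f ω : ℝ) * Complex.I) ∂P := by
  refine (LipschitzWith.of_dist_le_mul (K := ‖s‖₊) fun f g => ?_).continuous
  rw [dist_eq_norm, dist_eq_norm, ← integral_sub (integrable_cexp_Lp f s) (integrable_cexp_Lp g s)]
  calc _ ≤ ∫ ω, |s| * |(f - g) ω| ∂P := by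
        refine norm_integral_le_of_norm_le
          ((integrable_Lp_two (f - g)).abs.const_mul _) ?_
        filter_upwards [Lp.coeFn_sub f g] with ω hω
        rw [hω, ← abs_mul, Pi.sub_apply, mul_sub]
        exact norm_cexp_sub_cexp_le _ _
    _ ≤ _ := by
        rw [integral_const_mul]
        simp only [coe_nnnorm, Real.norm_eq_abs]
        gcongr
        exact integral_abs_le_norm _

theorem isCentredGaussian_iff (f : Lp ℝ 2 P) : IsCentredGaussian f ↔
    ∀ s : ℝ, ∫ ω, Complex.exp ((s * f ω : ℝ) * Complex.I) ∂P
      = Complex.exp (-((‖f‖ ^ 2 * s ^ 2 / 2 : ℝ) : ℂ)) := by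
  have : IsProbabilityMeasure (P.map f) :=
    Measure.isProbabilityMeasure_map (Lp.memLp f).1.aemeasurable
  have h2 : ∀ s : ℝ, charFun (gaussianReal 0 (‖f‖₊ ^ 2)) s
      = Complex.exp (-((‖f‖ ^ 2 * s ^ 2 / 2 : ℝ) : ℂ)) := fun s => by
    rw [charFun_gaussianReal]; push_cast; congr 1; simp
  constructor
  · intro h s
    rw [← charFun_map_Lp, h, h2]
  · intro h
    refine Measure.ext_of_charFun (funext fun s => ?_)
    rw [charFun_map_Lp, h, h2]

/-- Gaussianity amounts to identities between characteristic functions, and both sides depend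
continuously on `f` in `L²`. -/
theorem isClosed_isCentredGaussian : IsClosed {f : Lp ℝ 2 P | IsCentredGaussian f} := by
  simp only [isCentredGaussian_iff, Set.ofPred_forall]
  refine isClosed_iInter fun s => isClosed_eq (continuous_integral_cexp s) ?_
  fun_prop

/-- Send a Hilbert basis to independent standard normal variables, which are orthonormal in `L²`,
and extend isometrically. Finite combinations are Gaussian by independence, and their limits by
closedness. -/
theorem exists_isonormal (H : Type*) [NormedAddCommGroup H] [InnerProductSpace ℝ H]
    [CompleteSpace H] : ∃ (w : Set H) (P : Measure (w → ℝ)) (_ : IsProbabilityMeasure P)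
      (W : H →ₗᵢ[ℝ] Lp ℝ 2 P), ∀ z, IsCentredGaussian (W z) := by
  classical
  obtain ⟨w, b, -⟩ := exists_hilbertBasis ℝ H
  let P : Measure (w → ℝ) := Measure.infinitePi fun _ => gaussianReal 0 1
  let X : w → (w → ℝ) → ℝ := fun i ω => ω i
  have hXm : ∀ i, Measurable (X i) := fun i => measurable_pi_apply i
  have hXlaw : ∀ i, P.map (X i) = gaussianReal 0 1 := fun i =>
    (measurePreserving_eval_infinitePi (fun _ : w => gaussianReal 0 1) i).map_eq
  have hXind : iIndepFun X P := by
    rw [iIndepFun_iff_map_fun_eq_infinitePi_map (by fun_prop)]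
    simp only [hXlaw]
    exact Measure.map_id
  have hXg : ∀ i, HasGaussianLaw (X i) P := fun i => ⟨by rw [hXlaw]; infer_instance⟩
  have hX0 : ∀ i, ∫ ω, X i ω ∂P = 0 := fun i => by
    have := integral_map (μ := P) (φ := X i) (hXm i).aemeasurable
      (f := fun x => x) (by fun_prop)
    rw [← this, hXlaw, integral_id_gaussianReal]
  have hXv : ∀ i, ∫ ω, X i ω ^ 2 ∂P = 1 := fun i => by
    have := variance_map (μ := P) (X := id) (Y := X i) (by fun_prop) (by fun_prop)
    rw [hXlaw, variance_id_gaussianReal, Function.id_comp,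
      variance_of_integral_eq_zero (hXm i).aemeasurable (hX0 i)] at this
    simpa using this.symm
  have hXL : ∀ i, MemLp (X i) 2 P := fun i => (hXg i).memLp_two
  let ξ : w → Lp ℝ 2 P := fun i => (hXL i).toLp (X i)
  have hξ : ∀ i, ξ i =ᵐ[P] X i := fun i => (hXL i).coeFn_toLp
  have hortho : Orthonormal ℝ ξ := by
    rw [orthonormal_iff_ite]
    intro i j
    have h1 : inner ℝ (ξ i) (ξ j) = ∫ ω, X i ω * X j ω ∂P := by
      rw [L2.inner_def]
      refine integral_congr_ae ?_
      filter_upwards [hξ i, hξ j] with ω h1 h2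
      simp [h1, h2, mul_comm]
    rw [h1]
    split_ifs with hij
    · subst hij
      simpa [sq] using hXv i
    · have := (hXind.indepFun hij).integral_fun_mul_eq_mul_integral
        (hXm i).aestronglyMeasurable (hXm j).aestronglyMeasurable
      rw [this, hX0, zero_mul]
  let W : H →ₗᵢ[ℝ] Lp ℝ 2 P :=
    hortho.orthogonalFamily.linearIsometry.comp b.repr.toLinearIsometry
  refine ⟨w, P, inferInstance, W, fun z => ?_⟩
  obtain ⟨c, hsum⟩ : ∃ c : w → ℝ, HasSum (fun i => c i • ξ i) (W z) :=
    ⟨_, hortho.orthogonalFamily.hasSum_linearIsometry (b.repr z)⟩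
  refine isClosed_isCentredGaussian.mem_of_tendsto hsum (Eventually.of_forall fun F => ?_)
  have hae : (∑ i ∈ F, c i • ξ i : Lp ℝ 2 P) =ᵐ[P]
      fun ω => ∑ i : F, c i * X i ω := by
    refine (Lp.coeFn_finsetSum _ _).trans ?_
    have : ∀ᵐ ω ∂P, ∀ i ∈ F, (c i • ξ i : Lp ℝ 2 P) ω = c i * X i ω := by
      rw [Filter.eventually_all_finset]
      intro i _
      filter_upwards [hξ i, Lp.coeFn_smul (c i) (ξ i)] with ω h1 h2
      rw [h2, Pi.smul_apply, h1, smul_eq_mul]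
    filter_upwards [this] with ω hω
    rw [Finset.sum_apply, Finset.sum_congr rfl hω, ← Finset.sum_coe_sort]
  have hG : HasGaussianLaw (fun ω => ∑ i : F, c i * X i ω) P := by
    refine iIndepFun.hasGaussianLaw_fun_sum (X := fun (i : F) ω => c i * X i ω)
      (fun i => (hXg i).fun_smul (c i)) ?_
    exact (hXind.precomp Subtype.val_injective).comp (fun (i : F) x => c i * x)
      (fun i => by fun_prop)
  refine isCentredGaussian_of_hasGaussianLaw (hG.congr hae.symm) ?_
  rw [integral_congr_ae hae, integral_finsetSum Finset.univ
    fun (i : F) _ => ((hXg i).integrable.const_mul (c i))]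
  simp [integral_const_mul, hX0]

end Isonormal

/-! ### Gaussian measures with a given trace class covariance -/

section GaussianVariable

variable {H : Type*} [NormedAddCommGroup H] [InnerProductSpace ℝ H]

theorem countable_of_orthonormal [SecondCountableTopology H] {ι : Type*} {b : ι → H}
    (hb : Orthonormal ℝ b) : Countable ι := by
  refine Pairwise.countable_of_isOpen_disjoint (s := fun i => Metric.ball (b i) (1 / 2)) ?_
    (fun i => Metric.isOpen_ball) (fun i => ⟨b i, Metric.mem_ball_self (by norm_num)⟩)
  intro i j hij
  refine Metric.ball_disjoint_ball ?_
  have h1 : ‖b i - b j‖ * ‖b i - b j‖ = 2 := by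
    rw [norm_sub_mul_self_real, hb.2 hij, hb.1, hb.1]
    norm_num
  rw [dist_eq_norm]
  nlinarith [norm_nonneg (b i - b j)]

variable [CompleteSpace H] [SecondCountableTopology H] [MeasurableSpace H] [BorelSpace H]
  {Ω : Type*} [MeasurableSpace Ω] {P : Measure Ω}

/-- By Tonelli the sum of squares has finite expectation `∑ ‖f i‖²`. -/
theorem ae_summable_sq {ι : Type*} [Countable ι] (f : ι → Lp ℝ 2 P)
    (hf : Summable fun i => ‖f i‖ ^ 2) : ∀ᵐ ω ∂P, Summable fun i => f i ω ^ 2 := by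
  have hm : ∀ i, AEMeasurable (fun ω => ENNReal.ofReal (f i ω ^ 2)) P := fun i =>
    ((Lp.memLp (f i)).1.aemeasurable.pow_const 2).ennreal_ofReal
  have h1 : ∫⁻ ω, ∑' i, ENNReal.ofReal (f i ω ^ 2) ∂P ≠ ∞ := by
    rw [lintegral_tsum hm]
    have : ∀ i, ∫⁻ ω, ENNReal.ofReal (f i ω ^ 2) ∂P = ENNReal.ofReal (‖f i‖ ^ 2) := fun i => by
      rw [← integral_sq_Lp_two, ofReal_integral_eq_lintegral_ofReal (Lp.memLp (f i)).integrable_sq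
        (Eventually.of_forall fun ω => sq_nonneg _)]
    simp only [this]
    exact hf.tsum_ofReal_ne_top
  filter_upwards [ae_lt_top' (AEMeasurable.tsum hm) h1] with ω hω
  have := ENNReal.summable_toReal hω.ne
  simpa [ENNReal.toReal_ofReal, sq_nonneg] using this

/-- Take `T = ∑ W(C^{1/2} bᵢ) bᵢ`. The expected sum of squared coefficients is `∑ ⟨C bᵢ, bᵢ⟩`, so
finite trace is exactly what makes the series converge almost surely. -/
theorem exists_random_variable (W : H →ₗᵢ[ℝ] Lp ℝ 2 P) {C : H →L[ℝ] H} (hC : C.IsPositive)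
    (hCt : HasFiniteTrace C) :
    ∃ T : Ω → H, Measurable T ∧ ∀ y, ∀ᵐ ω ∂P, inner ℝ y (T ω) = W (sqrtOp C y) ω := by
  obtain ⟨w, b, hb⟩ := hCt
  have : Countable w := countable_of_orthonormal b.orthonormal
  have hsum : ∀ᵐ ω ∂P, Summable fun i => W (sqrtOp C (b i)) ω ^ 2 := by
    refine ae_summable_sq (fun i => W (sqrtOp C (b i))) (hb.congr fun i => ?_)
    rw [W.norm_map, norm_sqrtOp_sq hC]
  have hV : ∀ᵐ ω ∂P, Summable fun i => W (sqrtOp C (b i)) ω • b i := by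
    filter_upwards [hsum] with ω hω
    refine (b.orthonormal.orthogonalFamily.summable_iff_norm_sq_summable
      (fun i => W (sqrtOp C (b i)) ω)).2 ?_
    simpa using hω
  let T : Ω → H := fun ω => ∑' i, W (sqrtOp C (b i)) ω • b i
  have hT : AEMeasurable T P := by
    refine aemeasurable_of_tendsto_metrizable_ae (atTop : Filter (Finset w))
      (f := fun F ω => ∑ i ∈ F, W (sqrtOp C (b i)) ω • b i) (fun F => ?_) ?_
    · exact Finset.aemeasurable_fun_sum _ fun i _ =>
        (Lp.memLp (W (sqrtOp C (b i)))).1.aemeasurable.smul_const _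
    · filter_upwards [hV] with ω hω using hω.hasSum
  refine ⟨hT.mk, hT.measurable_mk, fun y => ?_⟩
  have h1 : HasSum (fun i => (inner ℝ (b i) y : ℝ) • W (sqrtOp C (b i))) (W (sqrtOp C y)) := by
    have := ((W.toContinuousLinearMap.comp (sqrtOp C)).hasSum (b.hasSum_repr y))
    simpa [b.repr_apply_apply] using this
  -- Convergence in `L²` over the finite subsets of the basis yields almost sure convergence along a
  -- sequence of finite sets. That is enough to identify the limit, as the full series already
  -- converges almost surely.
  obtain ⟨ns, hns, hlim⟩ := (tendstoInMeasure_of_tendsto_Lp h1).exists_seq_tendsto_ae'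
  have hfin : ∀ᵐ ω ∂P, ∀ F : Finset w,
      (∑ i ∈ F, (inner ℝ (b i) y : ℝ) • W (sqrtOp C (b i)) : Lp ℝ 2 P) ω
        = inner ℝ y (∑ i ∈ F, W (sqrtOp C (b i)) ω • b i) := by
    have hsm : ∀ᵐ ω ∂P, ∀ i, ((inner ℝ (b i) y : ℝ) • W (sqrtOp C (b i)) : Lp ℝ 2 P) ω
        = inner ℝ (b i) y * W (sqrtOp C (b i)) ω := by
      rw [ae_all_iff]
      intro i
      exact Lp.coeFn_smul _ _
    rw [ae_all_iff]
    intro F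
    filter_upwards [hsm, Lp.coeFn_finsetSum F
      fun i => (inner ℝ (b i) y : ℝ) • W (sqrtOp C (b i))] with ω h1 h2
    rw [h2, Finset.sum_apply, inner_sum]
    refine Finset.sum_congr rfl fun i _ => ?_
    rw [h1, inner_smul_right, real_inner_comm, mul_comm]
  filter_upwards [hT.ae_eq_mk, hV, hlim, hfin] with ω h2 h3 h4 h5
  rw [← h2]
  refine tendsto_nhds_unique ?_ h4
  simp only [h5]
  exact (continuous_const.inner continuous_id).continuousAt.tendsto.comp (h3.hasSum.comp hns)

variable [IsProbabilityMeasure P] {W : H →ₗᵢ[ℝ] Lp ℝ 2 P}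

omit [CompleteSpace H] in
theorem charFun_map_of_isonormal (hW : ∀ z, IsCentredGaussian (W z)) {R : H →L[ℝ] H}
    {T : Ω → H} (hT : Measurable T) (hTW : ∀ y, ∀ᵐ ω ∂P, inner ℝ y (T ω) = W (R y) ω) (y : H) :
    charFun (P.map T) y = Complex.exp (-((‖R y‖ ^ 2 / 2 : ℝ) : ℂ)) := by
  have h := (isCentredGaussian_iff _).1 (hW (R y)) 1
  rw [charFun_apply, integral_map hT.aemeasurable (by fun_prop)]
  rw [W.norm_map] at h
  simp only [one_mul, one_pow, mul_one] at h
  rw [← h]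
  refine integral_congr_ae ?_
  filter_upwards [hTW y] with ω hω
  rw [real_inner_comm, hω]

end GaussianVariable

section Gaussian

variable {H : Type*} [NormedAddCommGroup H] [InnerProductSpace ℝ H] [CompleteSpace H]
  [SecondCountableTopology H] [MeasurableSpace H] [BorelSpace H]

theorem covarianceBilin_eq_inner {μ : Measure H} [IsGaussian μ] (h0 : ∫ y, y ∂μ = 0) (x y : H) :
    covarianceBilin μ x y = inner ℝ (covarianceOperator μ x) y := by
  rw [covarianceBilin_apply IsGaussian.memLp_two_id, covarianceOperator_inner
    IsGaussian.memLp_two_id]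
  simp [h0]

theorem charFun_of_isGaussian {μ : Measure H} [IsGaussian μ] (h0 : ∫ y, y ∂μ = 0) (y : H) :
    charFun μ y = Complex.exp (-((inner ℝ (covarianceOperator μ y) y / 2 : ℝ) : ℂ)) := by
  rw [IsGaussian.charFun_eq', covarianceBilin_eq_inner h0]
  have : μ[id] = 0 := h0
  rw [this]
  simp

theorem isGaussian_of_charFun {C : H →L[ℝ] H} (hC : C.IsPositive) {μ : Measure H}
    [IsFiniteMeasure μ]
    (h : ∀ y, charFun μ y = Complex.exp (-((inner ℝ (C y) y / 2 : ℝ) : ℂ))) :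
    IsGaussian μ ∧ ∫ y, y ∂μ = 0 ∧ covarianceOperator μ = C := by
  let f : H →L[ℝ] H →L[ℝ] ℝ := (innerSL ℝ).comp C
  have hf : f.toBilinForm.IsPosSemidef :=
    ⟨⟨fun x y => by
      simp only [f, ContinuousLinearMap.toBilinForm_apply, ContinuousLinearMap.comp_apply,
        innerSL_apply_apply]
      rw [hC.inner_left_eq_inner_right, real_inner_comm]⟩,
     ⟨fun x => by simpa [f] using hC.inner_nonneg_left x⟩⟩
  have h' : ∀ t, charFun μ t = Complex.exp ((inner ℝ t (0 : H) : ℝ) * Complex.I - f t t / 2) := by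
    intro t
    rw [h]
    simp [f]
  have hG : IsGaussian μ := isGaussian_iff_gaussian_charFun.2 ⟨0, f, hf, h'⟩
  obtain ⟨h1, h2⟩ := gaussian_charFun_congr 0 f hf h'
  refine ⟨hG, h1.symm, ?_⟩
  ext x
  refine ext_inner_right ℝ fun y => ?_
  rw [← covarianceBilin_eq_inner h1.symm, ← h2]
  rfl

/-- The measure is the law of the random variable above. Its existence excludes the default value
`0` of `centredGaussian`. -/
theorem exists_gaussian {C : H →L[ℝ] H} (hC : C.IsPositive) (hCt : HasFiniteTrace C) :
    ∃ μ : Measure H, IsGaussian μ ∧ ∫ y, y ∂μ = 0 ∧ covarianceOperator μ = C := by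
  obtain ⟨w, P, hP, W, hW⟩ := exists_isonormal H
  obtain ⟨T, hT, hTW⟩ := exists_random_variable W hC hCt
  have := Measure.isProbabilityMeasure_map (μ := P) hT.aemeasurable
  refine ⟨P.map T, isGaussian_of_charFun hC fun y => ?_⟩
  rw [charFun_map_of_isonormal hW hT hTW, norm_sqrtOp_sq hC]

variable {C : H →L[ℝ] H} (hC : C.IsPositive) (hCt : HasFiniteTrace C)
include hC hCt

theorem isGaussian_centredGaussian : IsGaussian (centredGaussian C) := by
  have h := exists_gaussian hC hCt
  rw [centredGaussian, dif_pos h]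
  exact h.choose_spec.1

theorem charFun_centredGaussian (y : H) :
    charFun (centredGaussian C) y = Complex.exp (-((inner ℝ (C y) y / 2 : ℝ) : ℂ)) := by
  have h := exists_gaussian hC hCt
  have e : centredGaussian C = h.choose := by rw [centredGaussian, dif_pos h]
  obtain ⟨h1, h2, h3⟩ := h.choose_spec
  rw [e, charFun_of_isGaussian h2, h3]

/-- Integrals against `N_C` become expectations on a space that also carries `W`. There `W z` serves
as a meaningful `⟨C^{-1/2} y, z⟩`, also for those `z` outside the range of `C^{1/2}`. -/
theorem exists_isonormal_representation :
    ∃ (w : Set H) (P : Measure (w → ℝ)) (_ : IsProbabilityMeasure P)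
      (W : H →ₗᵢ[ℝ] Lp ℝ 2 P) (T : (w → ℝ) → H), (∀ z, IsCentredGaussian (W z)) ∧ Measurable T ∧
      (∀ y, ∀ᵐ ω ∂P, inner ℝ y (T ω) = W (sqrtOp C y) ω) ∧ P.map T = centredGaussian C := by
  obtain ⟨w, P, hP, W, hW⟩ := exists_isonormal H
  obtain ⟨T, hT, hTW⟩ := exists_random_variable W hC hCt
  refine ⟨w, P, hP, W, T, hW, hT, hTW, ?_⟩
  have := Measure.isProbabilityMeasure_map (μ := P) hT.aemeasurable
  have := isGaussian_centredGaussian hC hCt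
  refine Measure.ext_of_charFun (funext fun y => ?_)
  rw [charFun_map_of_isonormal hW hT hTW, norm_sqrtOp_sq hC, charFun_centredGaussian hC hCt]

end Gaussian

/-! ### The Cameron–Martin formula -/

section CameronMartin

variable {H : Type*} [NormedAddCommGroup H] [InnerProductSpace ℝ H]
  {Ω : Type*} [MeasurableSpace Ω] {P : Measure Ω}

theorem integrable_exp_of_isCentredGaussian {f : Lp ℝ 2 P} (hf : IsCentredGaussian f) (s : ℝ) :
    Integrable (fun ω => Real.exp (s * f ω)) P := by
  have h : Integrable (fun x => Real.exp (s * x)) (P.map f) := by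
    rw [hf]; exact integrable_exp_mul_gaussianReal s
  exact (integrable_map_measure (by fun_prop) (Lp.memLp f).1.aemeasurable).1 h

theorem integral_exp_of_isCentredGaussian {f : Lp ℝ 2 P} (hf : IsCentredGaussian f) (s : ℝ) :
    ∫ ω, Real.exp (s * f ω) ∂P = Real.exp (‖f‖ ^ 2 * s ^ 2 / 2) := by
  have := mgf_gaussianReal hf s
  rw [mgf] at this
  rw [this]
  simp

theorem integral_of_isCentredGaussian {f : Lp ℝ 2 P} (hf : IsCentredGaussian f) :
    ∫ ω, f ω ∂P = 0 := by
  have := integral_map (Lp.memLp f).1.aemeasurable (f := fun x : ℝ => x) (by fun_prop)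
  rw [← this, hf, integral_id_gaussianReal]

variable (W : H →ₗᵢ[ℝ] Lp ℝ 2 P)

/-- The Cameron–Martin density `exp (W z - ‖z‖² / 2)`. -/
noncomputable def cmDensity (z : H) (ω : Ω) : ℝ := Real.exp (W z ω - ‖z‖ ^ 2 / 2)

/-- The probability measure with density `cmDensity W z`. -/
noncomputable def cmMeasure (z : H) : Measure Ω :=
  P.withDensity fun ω => (cmDensity W z ω).toNNReal

theorem cmDensity_pos (z : H) (ω : Ω) : 0 < cmDensity W z ω := Real.exp_pos _

theorem measurable_cmDensity (z : H) : Measurable (cmDensity W z) := by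
  have h : Measurable (W z : Ω → ℝ) := (Lp.stronglyMeasurable (W z)).measurable
  unfold cmDensity
  fun_prop

variable {W} (hW : ∀ z, IsCentredGaussian (W z))

theorem integral_cmMeasure (z : H) (g : Ω → ℝ) :
    ∫ ω, g ω ∂(cmMeasure W z) = ∫ ω, cmDensity W z ω * g ω ∂P := by
  rw [cmMeasure, integral_withDensity_eq_integral_smul (measurable_cmDensity W z).real_toNNReal]
  refine integral_congr_ae (Eventually.of_forall fun ω => ?_)
  simp only [NNReal.smul_def, smul_eq_mul, Real.coe_toNNReal _ (cmDensity_pos W z ω).le]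

/-- By linearity of `W` the integrand is a constant times `exp W(z + s a)`, and `W(z + s a)` is
Gaussian with variance `‖z + s a‖²`. -/
theorem integral_exp_mul_cmDensity (hW : ∀ z, IsCentredGaussian (W z)) (z a : H) (s : ℝ) :
    ∫ ω, cmDensity W z ω * Real.exp (s * W a ω) ∂P
      = Real.exp (inner ℝ a z * s + ‖a‖ ^ 2 * s ^ 2 / 2) := by
  have h := integral_exp_of_isCentredGaussian (hW (z + s • a)) 1
  rw [W.norm_map, norm_add_sq_real, norm_smul, mul_pow, inner_smul_right, real_inner_comm,
    Real.norm_eq_abs, sq_abs] at h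
  have h2 : ∀ᵐ ω ∂P, cmDensity W z ω * Real.exp (s * W a ω)
      = Real.exp (1 * W (z + s • a) ω) * Real.exp (-(‖z‖ ^ 2 / 2)) := by
    rw [map_add, map_smul]
    filter_upwards [Lp.coeFn_add (W z) (s • W a), Lp.coeFn_smul s (W a)] with ω h1 h2
    rw [h1, Pi.add_apply, h2, Pi.smul_apply, cmDensity, ← Real.exp_add, ← Real.exp_add, smul_eq_mul]
    congr 1; ring
  rw [integral_congr_ae h2, integral_mul_const, h, ← Real.exp_add]
  congr 1; ring

theorem integrable_cmDensity (hW : ∀ z, IsCentredGaussian (W z)) (z : H) :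
    Integrable (cmDensity W z) P := by
  have := (integrable_exp_of_isCentredGaussian (hW z) 1).mul_const (Real.exp (-(‖z‖ ^ 2 / 2)))
  refine this.congr (Eventually.of_forall fun ω => ?_)
  simp only [cmDensity, ← Real.exp_add, one_mul, sub_eq_add_neg]

theorem integral_cmDensity (hW : ∀ z, IsCentredGaussian (W z)) (z : H) :
    ∫ ω, cmDensity W z ω ∂P = 1 := by
  have := integral_exp_mul_cmDensity hW z 0 0
  simpa using this

theorem isProbabilityMeasure_cmMeasure (hW : ∀ z, IsCentredGaussian (W z)) (z : H) :
    IsProbabilityMeasure (cmMeasure W z) := by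
  constructor
  rw [cmMeasure, withDensity_apply _ MeasurableSet.univ, Measure.restrict_univ]
  change ∫⁻ ω, ENNReal.ofReal (cmDensity W z ω) ∂P = 1
  rw [← ofReal_integral_eq_lintegral_ofReal (integrable_cmDensity hW z)
    (Eventually.of_forall fun ω => (cmDensity_pos W z ω).le), integral_cmDensity hW,
    ENNReal.ofReal_one]

/-- The preceding formula gives the moment generating function of `W a` under the new measure. It is
finite on the whole line and so determines the law: the mean moves by `⟨a, z⟩`, the variance stays.
-/
theorem map_cmMeasure (hW : ∀ z, IsCentredGaussian (W z)) (z a : H) :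
    (cmMeasure W z).map (W a) = gaussianReal (inner ℝ a z) (‖a‖₊ ^ 2) := by
  have := isProbabilityMeasure_cmMeasure hW z
  have hmgf : mgf id (gaussianReal (inner ℝ a z) (‖a‖₊ ^ 2)) = mgf (W a) (cmMeasure W z) := by
    rw [mgf_id_gaussianReal]
    ext s
    rw [mgf, integral_cmMeasure, integral_exp_mul_cmDensity hW]
    simp
  have hm : Measurable (W a : Ω → ℝ) := (Lp.stronglyMeasurable (W a)).measurable
  have h := eqOn_complexMGF_of_mgf hmgf
  simp only [integrableExpSet_id_gaussianReal, interior_univ, mem_univ, Set.ofPred_true] at h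
  have h2 := Measure.ext_of_complexMGF_eq aemeasurable_id hm.aemeasurable (eqOn_univ _ _ |>.1 h)
  rw [Measure.map_id] at h2
  exact h2.symm

theorem absolutelyContinuous_cmMeasure (z : H) : cmMeasure W z ≪ P :=
  withDensity_absolutelyContinuous _ _

variable [CompleteSpace H] [SecondCountableTopology H] [MeasurableSpace H] [BorelSpace H]

/-- Test with characteristic functions: `⟨y, T⟩ = W(R y)` acquires the mean `⟨R y, z⟩ = ⟨y, R z⟩`,
the effect of a translation by `R z`. -/
theorem map_cmMeasure_random_variable [IsProbabilityMeasure P]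
    (hW : ∀ z, IsCentredGaussian (W z)) {R : H →L[ℝ] H}
    (hR : R.IsPositive) {T : Ω → H} (hT : Measurable T)
    (hTW : ∀ y, ∀ᵐ ω ∂P, inner ℝ y (T ω) = W (R y) ω) (z : H) :
    (cmMeasure W z).map T = (P.map T).map (R z + ·) := by
  have := isProbabilityMeasure_cmMeasure hW z
  have := Measure.isProbabilityMeasure_map (μ := P) hT.aemeasurable
  refine Measure.ext_of_charFun (funext fun y => ?_)
  rw [charFun_map_const_add, charFun_map_of_isonormal hW hT hTW, charFun_apply,
    integral_map hT.aemeasurable (by fun_prop)]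
  have hm : Measurable (W (R y) : Ω → ℝ) := (Lp.stronglyMeasurable (W (R y))).measurable
  have h := charFun_gaussianReal (μ := inner ℝ (R y) z) (v := ‖R y‖₊ ^ 2) 1
  rw [← map_cmMeasure hW z (R y), charFun_apply_real, integral_map hm.aemeasurable (by fun_prop)]
    at h
  have e : ∫ ω, Complex.exp ((inner ℝ (T ω) y : ℝ) * Complex.I) ∂(cmMeasure W z)
      = ∫ ω, Complex.exp ((1 : ℝ) * (W (R y) ω : ℝ) * Complex.I) ∂(cmMeasure W z) := by
    refine integral_congr_ae ?_
    filter_upwards [(absolutelyContinuous_cmMeasure z).ae_le (hTW y)] with ω hω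
    rw [real_inner_comm, hω]
    simp
  rw [e, h, ← Complex.exp_add, hR.inner_left_eq_inner_right, real_inner_comm (R z)]
  congr 1
  push_cast
  simp only [one_mul, one_pow, mul_one]
  ring

/-- The Cameron–Martin formula. -/
theorem integral_shift_eq [IsProbabilityMeasure P]
    (hW : ∀ z, IsCentredGaussian (W z)) {R : H →L[ℝ] H}
    (hR : R.IsPositive) {T : Ω → H} (hT : Measurable T)
    (hTW : ∀ y, ∀ᵐ ω ∂P, inner ℝ y (T ω) = W (R y) ω) (z : H) {f : H → ℝ} (hf : Measurable f) :
    ∫ ω, f (R z + T ω) ∂P = ∫ ω, cmDensity W z ω * f (T ω) ∂P := by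
  have hm : Measurable fun y => R z + y := by fun_prop
  rw [← integral_cmMeasure z (fun ω => f (T ω)),
    ← integral_map hT.aemeasurable hf.aestronglyMeasurable,
    map_cmMeasure_random_variable hW hR hT hTW,
    integral_map hm.aemeasurable hf.aestronglyMeasurable,
    integral_map (f := fun y => f (R z + y)) hT.aemeasurable (hf.comp hm).aestronglyMeasurable]

omit [CompleteSpace H] [SecondCountableTopology H] [MeasurableSpace H] [BorelSpace H]

theorem memLp_cmDensity (hW : ∀ z, IsCentredGaussian (W z)) (z : H) :
    MemLp (cmDensity W z) 2 P := by
  rw [memLp_two_iff_integrable_sq (measurable_cmDensity W z).aestronglyMeasurable]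
  have := (integrable_exp_of_isCentredGaussian (hW z) 2).mul_const (Real.exp (-‖z‖ ^ 2))
  refine this.congr (Eventually.of_forall fun ω => ?_)
  simp only [cmDensity, ← Real.exp_add, sq (Real.exp _)]
  congr 1; ring

theorem integral_cmDensity_sq (hW : ∀ z, IsCentredGaussian (W z)) (z : H) :
    ∫ ω, cmDensity W z ω ^ 2 ∂P = Real.exp (‖z‖ ^ 2) := by
  have h : ∀ ω, cmDensity W z ω ^ 2
      = cmDensity W z ω * Real.exp (1 * W z ω) * Real.exp (-(‖z‖ ^ 2 / 2)) := fun ω => by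
    simp only [cmDensity, ← Real.exp_add, sq (Real.exp _)]
    congr 1; ring
  simp only [h]
  rw [integral_mul_const, integral_exp_mul_cmDensity hW, ← Real.exp_add, real_inner_self_eq_norm_sq]
  congr 1; ring

theorem integral_cmDensity_mul (hW : ∀ z, IsCentredGaussian (W z)) (z : H) :
    ∫ ω, cmDensity W z ω * W z ω ∂P = ‖z‖ ^ 2 := by
  have hm : Measurable (W z : Ω → ℝ) := (Lp.stronglyMeasurable (W z)).measurable
  rw [← integral_cmMeasure z (fun ω => W z ω)]
  have := integral_map (μ := cmMeasure W z) hm.aemeasurable (f := fun x : ℝ => x) (by fun_prop)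
  rw [← this, map_cmMeasure hW, integral_id_gaussianReal, real_inner_self_eq_norm_sq]

/-- The squared `L²` norm of the remainder is exactly `e^a - 1 - a` with `a = ‖h‖²`, which is at
most `a²` for `a ≤ 1`. The `L¹` norm is below the `L²` norm on a probability space. -/
theorem integral_abs_cmDensity_sub_le [IsProbabilityMeasure P]
    (hW : ∀ z, IsCentredGaussian (W z)) {h : H} (hh : ‖h‖ ≤ 1) :
    ∫ ω, |cmDensity W h ω - 1 - W h ω| ∂P ≤ ‖h‖ ^ 2 := by
  have hρ := memLp_cmDensity hW h
  have hw := Lp.memLp (W h)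
  have h1 : MemLp (fun _ : Ω => (1 : ℝ)) 2 P := memLp_const 1
  have hL : MemLp (fun ω => cmDensity W h ω - 1 - W h ω) 2 P := (hρ.sub h1).sub hw
  set X := hL.toLp _ with hX
  have hXe : X =ᵐ[P] fun ω => cmDensity W h ω - 1 - W h ω := hL.coeFn_toLp
  have hsq : ∫ ω, X ω ^ 2 ∂P = Real.exp (‖h‖ ^ 2) - 1 - ‖h‖ ^ 2 := by
    have e : ∀ᵐ ω ∂P, X ω ^ 2 = cmDensity W h ω ^ 2 + 1 + W h ω ^ 2 - 2 * cmDensity W h ω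
        - 2 * (cmDensity W h ω * W h ω) + 2 * W h ω := by
      filter_upwards [hXe] with ω hω
      rw [hω]; ring
    have i1 := hρ.integrable_sq
    have i2 : Integrable (fun _ : Ω => (1 : ℝ)) P := integrable_const 1
    have i3 := hw.integrable_sq
    have i4 := (integrable_cmDensity hW h).const_mul 2
    have i5 := (hρ.integrable_mul hw).const_mul 2
    have i6 := (integrable_Lp_two (W h)).const_mul 2
    simp only [Pi.mul_apply] at i5
    have j2 := i1.fun_add i2
    have j3 := j2.fun_add i3
    have j4 := j3.sub' i4
    have j5 := j4.sub' i5
    rw [integral_congr_ae e, integral_add j5 i6, integral_sub j4 i5,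
      integral_sub j3 i4, integral_add j2 i3, integral_add i1 i2, integral_const_mul, integral_const_mul,
      integral_const_mul, integral_cmDensity_sq hW, integral_sq_Lp_two, integral_cmDensity hW,
      integral_cmDensity_mul hW, integral_of_isCentredGaussian (hW h), W.norm_map]
    simp
    ring
  calc ∫ ω, |cmDensity W h ω - 1 - W h ω| ∂P = ∫ ω, |X ω| ∂P := by
        refine integral_congr_ae ?_
        filter_upwards [hXe] with ω hω
        rw [hω]
    _ ≤ ‖X‖ := integral_abs_le_norm X
    _ ≤ ‖h‖ ^ 2 := by
        rw [← sq_le_sq₀ (norm_nonneg _) (by positivity), ← integral_sq_Lp_two, hsq]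
        have hle : |‖h‖ ^ 2| ≤ 1 := by
          rw [abs_of_nonneg (by positivity)]; exact pow_le_one₀ (norm_nonneg _) hh
        exact (le_abs_self _).trans (Real.abs_exp_sub_one_sub_id_le hle)

end CameronMartin

/-! ### Differentiability of Gaussian averages along the Cameron–Martin space -/

section Regularity

/-- A quadratic remainder that is uniform in the base point makes `L` locally Lipschitz, so its
continuity need not be assumed. Compare the expansions from `z` to `z + k`, from `z + k` to `z + k +
w`, and from `z` directly to `z + k + w`, where `‖w‖ = ‖k‖`. -/
theorem contDiff_one_of_quadratic_remainder {E : Type*} [NormedAddCommGroup E] [NormedSpace ℝ E]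
    {g : E → ℝ} {L : E → E →L[ℝ] ℝ} {K : ℝ} (hK : 0 ≤ K)
    (h : ∀ z v, ‖v‖ ≤ 1 → |g (z + v) - g z - L z v| ≤ K * ‖v‖ ^ 2) :
    ContDiff ℝ 1 g ∧ ∀ z, HasFDerivAt g (L z) z := by
  have hd : ∀ z, HasFDerivAt g (L z) z := by
    intro z
    rw [hasFDerivAt_iff_isLittleO_nhds_zero]
    refine Asymptotics.IsBigO.trans_isLittleO (g := fun v : E => ‖v‖ ^ 2) ?_
      (Asymptotics.isLittleO_norm_pow_id one_lt_two)
    refine Asymptotics.IsBigO.of_bound K ?_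
    filter_upwards [Metric.ball_mem_nhds (0 : E) one_pos] with v hv
    rw [mem_ball_zero_iff] at hv
    simpa using h z v hv.le
  refine ⟨contDiff_one_iff_fderiv.2 ⟨fun z => (hd z).differentiableAt, ?_⟩, hd⟩
  have hfd : fderiv ℝ g = L := funext fun z => (hd z).fderiv
  rw [hfd, continuous_iff_continuousAt]
  intro z
  have key : ∀ k : E, ‖k‖ ≤ 1 / 2 → ‖L (z + k) - L z‖ ≤ 6 * K * ‖k‖ := by
    intro k hk
    refine ContinuousLinearMap.opNorm_le_bound _ (by positivity) fun v => ?_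
    rcases eq_or_ne v 0 with rfl | hv
    · simp
    rcases eq_or_ne k 0 with rfl | hk0
    · simp
    have hvn : 0 < ‖v‖ := norm_pos_iff.2 hv
    have hkn : 0 < ‖k‖ := norm_pos_iff.2 hk0
    set c : ℝ := ‖k‖ / ‖v‖ with hc
    have hcpos : 0 < c := by positivity
    have hw : ‖c • v‖ = ‖k‖ := by
      rw [norm_smul, Real.norm_of_nonneg hcpos.le, hc]; field_simp
    have hs : ‖k + c • v‖ ≤ 2 * ‖k‖ := (norm_add_le _ _).trans (by rw [hw]; linarith)
    have h1 := h (z + k) (c • v) (by rw [hw]; linarith)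
    have h2 := h z (k + c • v) (by linarith)
    have h3 := h z k (by linarith)
    have h2' : K * ‖k + c • v‖ ^ 2 ≤ K * (2 * ‖k‖) ^ 2 := by gcongr
    rw [hw] at h1
    rw [← add_assoc, map_add] at h2
    -- The three remainders are at most `K‖k‖²`, `K(2‖k‖)²` and `K‖k‖²`, whence `6 = 1 + 4 + 1`.
    have h4 : |(L (z + k) - L z) (c • v)| ≤ 6 * K * ‖k‖ ^ 2 := by
      rw [sub_apply, abs_le]
      rw [abs_le] at h1 h2 h3
      constructor <;> nlinarith
    rw [map_smul, smul_eq_mul, abs_mul, abs_of_pos hcpos] at h4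
    rw [Real.norm_eq_abs]
    have : |(L (z + k) - L z) v| = (c * |(L (z + k) - L z) v|) * (‖v‖ / ‖k‖) := by
      rw [hc]; field_simp
    rw [this]
    calc _ ≤ 6 * K * ‖k‖ ^ 2 * (‖v‖ / ‖k‖) := by gcongr
      _ = _ := by field_simp
  rw [ContinuousAt, tendsto_iff_norm_sub_tendsto_zero]
  have h0 : Tendsto (fun y : E => 6 * K * ‖y - z‖) (𝓝 z) (𝓝 0) := by
    have : Continuous fun y : E => 6 * K * ‖y - z‖ := by fun_prop
    simpa using this.tendsto z
  refine squeeze_zero' (Eventually.of_forall fun _ => norm_nonneg _) ?_ h0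
  filter_upwards [Metric.ball_mem_nhds z (by norm_num : (0 : ℝ) < 1 / 2)] with y hy
  rw [mem_ball_iff_norm] at hy
  have := key (y - z) hy.le
  rwa [add_sub_cancel] at this

variable {H : Type*} [NormedAddCommGroup H] [InnerProductSpace ℝ H] [CompleteSpace H]
  [SecondCountableTopology H] [MeasurableSpace H] [BorelSpace H]

/-- Gaussian averages are continuously differentiable in the directions of the Cameron–Martin
space. -/
theorem contDiff_integral_centredGaussian {C : H →L[ℝ] H} (hC : C.IsPositive)
    (hCt : HasFiniteTrace C) {f : H → ℝ} (hf : Measurable f) {K : ℝ} (hfK : ∀ x, |f x| ≤ K) :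
    ContDiff ℝ 1 (fun z => ∫ y, f (sqrtOp C z + y) ∂(centredGaussian C)) ∧
      ∀ z, ‖fderiv ℝ (fun z => ∫ y, f (sqrtOp C z + y) ∂(centredGaussian C)) z‖ ≤ K := by
  obtain ⟨w, P, hP, W, T, hW, hT, hTW, hlaw⟩ := exists_isonormal_representation hC hCt
  have hR := sqrtOp_isPositive hC
  set R := sqrtOp C with hRdef
  have hK : 0 ≤ K := (abs_nonneg _).trans (hfK 0)
  have hFm : ∀ z, Measurable fun ω => f (R z + T ω) := fun z => hf.comp (hT.const_add _)
  have hF : ∀ z, MemLp (fun ω => f (R z + T ω)) 2 P := fun z =>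
    MemLp.of_bound (hFm z).aestronglyMeasurable K (Eventually.of_forall fun ω => hfK _)
  have hg : ∀ z, ∫ y, f (R z + y) ∂(centredGaussian C) = ∫ ω, f (R z + T ω) ∂P := fun z => by
    rw [← hlaw, integral_map (f := fun y => f (R z + y)) hT.aemeasurable
      (hf.comp (measurable_const_add (R z))).aestronglyMeasurable]
  simp only [hg]
  let L : H → H →L[ℝ] ℝ := fun z =>
    (innerSL ℝ ((hF z).toLp _)).comp W.toContinuousLinearMap
  have hL : ∀ z h, L z h = ∫ ω, f (R z + T ω) * W h ω ∂P := by
    intro z h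
    change inner ℝ ((hF z).toLp _) (W h) = _
    rw [L2.inner_def]
    refine integral_congr_ae ?_
    filter_upwards [(hF z).coeFn_toLp] with ω hω
    simp [hω, mul_comm]
  have hLn : ∀ z, ‖L z‖ ≤ K := by
    intro z
    refine ContinuousLinearMap.opNorm_le_bound _ hK fun h => ?_
    rw [hL]
    calc _ ≤ ∫ ω, K * |W h ω| ∂P := by
          refine norm_integral_le_of_norm_le ((integrable_Lp_two _).abs.const_mul _)
            (Eventually.of_forall fun ω => ?_)
          rw [Real.norm_eq_abs, abs_mul]
          gcongr
          exact hfK _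
      _ ≤ K * ‖h‖ := by
          rw [integral_const_mul, ← W.norm_map h]
          gcongr
          exact integral_abs_le_norm _
  have hrem : ∀ z h, ‖h‖ ≤ 1 → |∫ ω, f (R (z + h) + T ω) ∂P - ∫ ω, f (R z + T ω) ∂P - L z h|
      ≤ K * ‖h‖ ^ 2 := by
    intro z h hh
    have hcm := integral_shift_eq hW hR hT hTW h (hf.comp (measurable_const_add (R z)))
    simp only [Function.comp_apply] at hcm
    -- The formula is applied to the increment `h` alone, with `f(R z + ·)` as integrand. The
    -- remainder bound is therefore uniform in `z`.
    have e1 : ∫ ω, f (R (z + h) + T ω) ∂P = ∫ ω, cmDensity W h ω * f (R z + T ω) ∂P := by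
      rw [← hcm]
      simp only [map_add, add_assoc]
    have i1 : Integrable (fun ω => cmDensity W h ω * f (R z + T ω)) P :=
      (memLp_cmDensity hW h).integrable_mul (hF z)
    have i2 : Integrable (fun ω => f (R z + T ω)) P := (hF z).integrable (by norm_num)
    have i3 : Integrable (fun ω => f (R z + T ω) * W h ω) P :=
      (hF z).integrable_mul (Lp.memLp (W h))
    have i4 : Integrable (fun ω => |cmDensity W h ω - 1 - W h ω|) P :=
      (((integrable_cmDensity hW h).sub (integrable_const 1)).sub (integrable_Lp_two (W h))).abs
    rw [e1, hL, ← integral_sub i1 i2, ← integral_sub (i1.sub' i2) i3, ← Real.norm_eq_abs]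
    calc _ ≤ ∫ ω, K * |cmDensity W h ω - 1 - W h ω| ∂P := by
          refine norm_integral_le_of_norm_le (i4.const_mul K) (Eventually.of_forall fun ω => ?_)
          rw [show cmDensity W h ω * f (R z + T ω) - f (R z + T ω) - f (R z + T ω) * W h ω
            = f (R z + T ω) * (cmDensity W h ω - 1 - W h ω) by ring, Real.norm_eq_abs, abs_mul]
          gcongr
          exact hfK _
      _ ≤ K * ‖h‖ ^ 2 := by
          rw [integral_const_mul]
          gcongr
          exact integral_abs_cmDensity_sub_le hW hh
  obtain ⟨h1, h2⟩ := contDiff_one_of_quadratic_remainder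
    (g := fun z => ∫ ω, f (R z + T ω) ∂P) hK hrem
  exact ⟨h1, fun z => by rw [(h2 z).fderiv]; exact hLn z⟩

end Regularity

/-! ### Measurable dependence of a measure on a parameter via characteristic functions -/

section ParameterMeasure

variable {H : Type*} [NormedAddCommGroup H] [InnerProductSpace ℝ H]
  [MeasurableSpace H] [BorelSpace H] {N : ℝ → Measure H} [∀ t, IsProbabilityMeasure (N t)]

/-- In finite dimension, convergence of characteristic functions implies weak convergence. In
infinite dimension this would require tightness, hence the projection. -/
theorem continuous_lintegral_projection (h : ∀ y, Continuous fun t => charFun (N t) y)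
    (U : Submodule ℝ H) [FiniteDimensional ℝ U] (g : H →ᵇ ℝ≥0) :
    Continuous fun t => ∫⁻ y, g (U.starProjection y) ∂(N t) := by
  have hm : Measurable fun y => U.orthogonalProjectionOnto y :=
    (U.orthogonalProjectionOnto).continuous.measurable
  have hP : ∀ t, IsProbabilityMeasure ((N t).map fun y => U.orthogonalProjectionOnto y) := fun t =>
    Measure.isProbabilityMeasure_map hm.aemeasurable
  let μ : ℝ → ProbabilityMeasure U := fun t => ⟨(N t).map fun y => U.orthogonalProjectionOnto y, hP t⟩
  have hchar : ∀ t (u : U), charFun (μ t : Measure U) u = charFun (N t) (u : H) := fun t u => by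
    change charFun ((N t).map fun y => U.orthogonalProjectionOnto y) u = _
    rw [charFun_apply, charFun_apply, integral_map hm.aemeasurable (by fun_prop)]
    refine integral_congr_ae (Eventually.of_forall fun y => ?_)
    simp only [Submodule.inner_orthogonalProjectionOnto_eq_of_mem_right]
  let g' : U →ᵇ ℝ≥0 := g.compContinuous ⟨fun u : U => (u : H), continuous_subtype_val⟩
  have hint : ∀ t, ∫⁻ y, g (U.starProjection y) ∂(N t) = ∫⁻ u, g' u ∂(μ t : Measure U) := fun t => by
    change _ = ∫⁻ u, g' u ∂((N t).map fun y => U.orthogonalProjectionOnto y)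
    rw [lintegral_map (by fun_prop) hm]
    rfl
  simp only [hint]
  rw [continuous_iff_seqContinuous]
  intro u t hu
  have hlim : Tendsto (fun n => μ (u n)) atTop (𝓝 (μ t)) := by
    refine ProbabilityMeasure.tendsto_of_tendsto_charFun fun y => ?_
    simp only [hchar]
    exact ((h y).tendsto t).comp hu
  exact (ProbabilityMeasure.tendsto_iff_forall_lintegral_tendsto.1 hlim) g'

/-- Project onto the spans of initial segments of a dense sequence. The integrals are then
continuous in `t`, and they converge pointwise by dominated convergence; continuity is lost in the
limit, measurability is not. -/
theorem measurable_lintegral_of_continuous_charFun [CompleteSpace H] [SecondCountableTopology H]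
    (h : ∀ y, Continuous fun t => charFun (N t) y) (g : H →ᵇ ℝ≥0) :
    Measurable fun t => ∫⁻ y, g y ∂(N t) := by
  let U : ℕ → Submodule ℝ H := fun n =>
    Submodule.span ℝ ((TopologicalSpace.denseSeq H) '' (Finset.range n : Set ℕ))
  have hfin : ∀ n, FiniteDimensional ℝ (U n) := fun n =>
    FiniteDimensional.span_of_finite ℝ ((Finset.finite_toSet _).image _)
  have hmono : Monotone U := fun m n hmn => Submodule.span_mono
    (image_mono (by simpa using Finset.range_mono hmn))
  have hdense : ⊤ ≤ (⨆ n, U n).topologicalClosure := by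
    intro x _
    refine closure_mono ?_ (TopologicalSpace.denseRange_denseSeq H x)
    rintro _ ⟨k, rfl⟩
    refine Submodule.mem_iSup_of_mem (k + 1) (Submodule.subset_span ⟨k, ?_, rfl⟩)
    simp
  have hproj : ∀ y, Tendsto (fun n => (U n).starProjection y) atTop (𝓝 y) := fun y =>
    Submodule.starProjection_tendsto_self U hmono y hdense
  refine measurable_of_tendsto_metrizable
    (fun n => (continuous_lintegral_projection h (U n) g).measurable) ?_
  rw [tendsto_pi_nhds]
  intro t
  let gs : ℕ → H →ᵇ ℝ≥0 := fun n =>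
    g.compContinuous ⟨fun y => (U n).starProjection y, ((U n).starProjection).continuous⟩
  obtain ⟨c, hc⟩ := g.isBounded_range.bddAbove
  refine tendsto_lintegral_nn_filter_of_le_const (N t) (fs := gs) (c := c)
    (Eventually.of_forall fun n => Eventually.of_forall fun y => ?_)
    (Eventually.of_forall fun y => ?_)
  · exact hc ⟨_, rfl⟩
  · exact (g.continuous.tendsto y).comp (hproj y)

/-- Closed sets form a generating π-system, and the indicator of a closed set is a pointwise limit
of bounded continuous functions. -/
theorem measurable_of_continuous_charFun [CompleteSpace H] [SecondCountableTopology H]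
    (h : ∀ y, Continuous fun t => charFun (N t) y) : Measurable N := by
  refine Measurable.measure_of_isPiSystem_of_isProbabilityMeasure
    (S := {s | IsClosed s}) ?_ isPiSystem_isClosed fun s hs => ?_
  · rw [← borel_eq_generateFrom_isClosed]; exact BorelSpace.measurable_eq
  · have hs' : IsClosed s := hs
    refine measurable_of_tendsto_metrizable
      (fun n => measurable_lintegral_of_continuous_charFun h (hs'.apprSeq n)) ?_
    rw [tendsto_pi_nhds]
    exact fun t => HasOuterApproxClosed.tendsto_lintegral_apprSeq hs' (N t)

end ParameterMeasure

/-! ### The covariance operators -/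

section Covariance

variable {H : Type*} [NormedAddCommGroup H] [InnerProductSpace ℝ H] [CompleteSpace H]
  [SecondCountableTopology H] (S : C0Semigroup H) (Q : H →L[ℝ] H)

theorem inner_covOp (t : ℝ) (x y : H) : (inner ℝ (covOp S Q t x) y : ℝ)
    = ∫ s in Ioc 0 t, inner ℝ (Q ((S.op s).adjoint x)) ((S.op s).adjoint y) := by
  change inner ℝ (∫ s in Ioc 0 t, S.op s (Q ((S.op s).adjoint x))) y = _
  rw [real_inner_comm, ← integral_inner (integrableOn_cov S Q t x)]
  refine integral_congr_ae (Eventually.of_forall fun s => ?_)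
  simp only
  rw [real_inner_comm, ContinuousLinearMap.adjoint_inner_right]

theorem integrableOn_inner_cov (t : ℝ) (x y : H) : IntegrableOn
    (fun s => (inner ℝ (Q ((S.op s).adjoint x)) ((S.op s).adjoint y) : ℝ)) (Ioc 0 t) := by
  refine ((integrableOn_cov S Q t x).const_inner (𝕜 := ℝ) y).congr
    (Eventually.of_forall fun s => ?_)
  simp only
  rw [real_inner_comm, ContinuousLinearMap.adjoint_inner_right]

variable {Q}

theorem covOp_isPositive (hQ : Q.IsPositive) (t : ℝ) : (covOp S Q t).IsPositive := by
  rw [ContinuousLinearMap.isPositive_iff]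
  refine ⟨fun x y => ?_, fun x => ?_⟩
  · change inner ℝ (covOp S Q t x) y = inner ℝ x (covOp S Q t y)
    rw [real_inner_comm (covOp S Q t y) x, inner_covOp, inner_covOp]
    refine integral_congr_ae (Eventually.of_forall fun s => ?_)
    simp only
    rw [hQ.inner_left_eq_inner_right, real_inner_comm]
  · rw [inner_covOp]
    exact integral_nonneg fun s => hQ.inner_nonneg_left _

theorem covOp_of_nonpos (Q : H →L[ℝ] H) {t : ℝ} (ht : t ≤ 0) : covOp S Q t = 0 := by
  ext x
  change ∫ s in Ioc 0 t, S.op s (Q ((S.op s).adjoint x)) = 0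
  rw [Ioc_eq_empty (not_lt.2 ht)]
  simp

theorem hasFiniteTrace_covOp (htrace : ∀ t : ℝ, 0 < t → HasFiniteTrace (covOp S Q t)) (t : ℝ) :
    HasFiniteTrace (covOp S Q t) := by
  rcases lt_or_ge 0 t with ht | ht
  · exact htrace t ht
  · obtain ⟨w, b, -⟩ := exists_hilbertBasis ℝ H
    exact ⟨w, b, by simp [covOp_of_nonpos S Q ht]⟩

/-- This is the primitive of the integrand cut off at negative times, where `covOp` is zero by the
empty integral. Working on all of `ℝ` lets `N_{Q_t}` be treated as a kernel. -/
theorem continuous_inner_covOp (Q : H →L[ℝ] H) (x y : H) :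
    Continuous fun t => (inner ℝ (covOp S Q t x) y : ℝ) := by
  let g : ℝ → ℝ := (Ioi (0 : ℝ)).indicator
    fun s => inner ℝ (Q ((S.op s).adjoint x)) ((S.op s).adjoint y)
  have hI : ∀ a b, Ioc a b ∩ Ioi (0 : ℝ) ⊆ Ioc 0 b := fun a b s hs => ⟨hs.2, hs.1.2⟩
  have hg : ∀ a b, IntervalIntegrable g volume a b := by
    have : ∀ a b, IntegrableOn g (Ioc a b) := fun a b => by
      rw [IntegrableOn, integrable_indicator_iff measurableSet_Ioi, IntegrableOn,
        Measure.restrict_restrict measurableSet_Ioi, inter_comm]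
      exact (integrableOn_inner_cov S Q b x y).mono_set (hI a b)
    exact fun a b => ⟨this a b, this b a⟩
  have hc := intervalIntegral.continuous_primitive hg 0
  convert hc using 2 with t
  rw [inner_covOp]
  rcases le_or_gt t 0 with ht | ht
  · rw [Ioc_eq_empty (not_lt.2 ht), intervalIntegral.integral_symm,
      intervalIntegral.integral_of_le ht]
    rw [setIntegral_congr_fun (g := fun _ => (0 : ℝ)) measurableSet_Ioc fun s hs => ?_]
    · simp
    · exact indicator_of_notMem (not_lt.2 hs.2) _
  · rw [intervalIntegral.integral_of_le ht.le]
    refine setIntegral_congr_fun measurableSet_Ioc fun s hs => ?_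
    simp only [g, indicator_of_mem (show s ∈ Ioi (0 : ℝ) from hs.1)]

/-- If `Q_t^{1/2} x = 0`, then `⟨Q e^{sA*} x, e^{sA*} x⟩` integrates to zero, and `Ker Q = 0` gives
`e^{sA*} x = 0` for almost every `s ∈ (0,t]`. Letting `s ↓ 0` in `⟨x, e^{sA} y⟩ = 0` gives `⟨x, y⟩ =
0`. -/
theorem sqrtOp_covOp_injective (hQ : Q.IsPositive) (hQker : ∀ x, Q x = 0 → x = 0) {t : ℝ}
    (ht : 0 < t) : Function.Injective (sqrtOp (covOp S Q t)) := by
  rw [injective_iff_map_eq_zero]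
  intro x hx
  have h0 : inner ℝ (covOp S Q t x) x = 0 := by
    rw [← norm_sqrtOp_sq (covOp_isPositive S hQ t), hx]; simp
  rw [inner_covOp, integral_eq_zero_iff_of_nonneg (fun s => hQ.inner_nonneg_left _)
    (integrableOn_inner_cov S Q t x x)] at h0
  have h1 : ∀ᵐ s ∂(volume.restrict (Ioc 0 t)), (S.op s).adjoint x = 0 := by
    filter_upwards [h0] with s hs
    refine hQker _ ?_
    simp only [Pi.zero_apply] at hs
    rw [← sqrtOp_apply_sqrtOp hQ]
    have : ‖sqrtOp Q ((S.op s).adjoint x)‖ ^ 2 = 0 := by rw [norm_sqrtOp_sq hQ, hs]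
    rw [norm_eq_zero.1 (pow_eq_zero_iff two_ne_zero |>.1 this), map_zero]
  refine ext_inner_right ℝ fun y => ?_
  rw [inner_zero_left]
  have hlim : Tendsto (fun s => (inner ℝ x (S.op s y) : ℝ)) (𝓝[>] 0) (𝓝 (inner ℝ x y)) := by
    have h := ((S.continuousOn_orbit y) 0 self_mem_Ici).tendsto.mono_left
      (nhdsWithin_mono 0 (Ioi_subset_Ici_self (a := (0 : ℝ))))
    rw [S.op_zero] at h
    exact tendsto_const_nhds.inner h
  -- A null set contains no interval `(0, ε)`, so good times accumulate at `0`.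
  have hfreq : ∃ᶠ s in 𝓝[>] (0 : ℝ), (inner ℝ x (S.op s y) : ℝ) = 0 := by
    rw [frequently_nhdsWithin_iff, Filter.frequently_iff]
    intro V hV
    obtain ⟨ε, hε, hεV⟩ := Metric.mem_nhds_iff.1 hV
    rw [ae_restrict_iff' measurableSet_Ioc] at h1
    have hpos : 0 < min t (ε / 2) := by positivity
    obtain ⟨s, hs, hs2⟩ : ∃ s ∈ Ioo 0 (min t (ε / 2)), (S.op s).adjoint x = 0 := by
      by_contra! hcon
      have hsub : Ioo 0 (min t (ε / 2)) ⊆ {s | ¬ (s ∈ Ioc 0 t → (S.op s).adjoint x = 0)} :=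
        fun s hs hs' => hcon s hs (hs' ⟨hs.1, (hs.2.trans_le (min_le_left _ _)).le⟩)
      have := measure_mono_null hsub h1
      rw [Real.volume_Ioo, sub_zero, ENNReal.ofReal_eq_zero] at this
      exact absurd this (not_le.2 hpos)
    refine ⟨s, hεV ?_, ?_, hs.1⟩
    · rw [Metric.mem_ball, Real.dist_eq, sub_zero, abs_of_pos hs.1]
      exact (hs.2.trans_le (min_le_right _ _)).trans (by linarith)
    · rw [← ContinuousLinearMap.adjoint_inner_left, hs2, inner_zero_left]
  by_contra hne
  have := hlim.eventually_ne hne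
  exact hfreq (this.mono fun s hs => hs)

end Covariance

/-! ### Smoothing properties of the Ornstein–Uhlenbeck semigroup -/

/-- The standing assumptions on the semigroup and the covariance. -/
structure IsSmoothing {H : Type*} [NormedAddCommGroup H] [InnerProductSpace ℝ H] [CompleteSpace H]
    [SecondCountableTopology H] (S : C0Semigroup H) (Q : H →L[ℝ] H) (δ C : ℝ) : Prop where
  isPositive : Q.IsPositive
  ker_eq_zero : ∀ x, Q x = 0 → x = 0
  hasFiniteTrace : ∀ t : ℝ, 0 < t → HasFiniteTrace (covOp S Q t)
  range_subset : ∀ t : ℝ, 0 < t → range (S.op t) ⊆ range (sqrtOp (covOp S Q t))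
  exponent_pos : 0 < δ
  exponent_lt_one : δ < 1
  const_pos : 0 < C
  norm_Lam_le : ∀ t : ℝ, 0 < t → ∀ h : H, ‖Lam S Q t h‖ ≤ C / t ^ δ * ‖h‖

theorem C0Semigroup.continuous_orbit {H : Type*} [NormedAddCommGroup H] [InnerProductSpace ℝ H]
    (S : C0Semigroup H) (x : H) :
    Continuous fun t => S.op (max t 0) x :=
  (S.continuousOn_orbit x).comp_continuous (by fun_prop) fun t => le_max_right t 0

section OrnsteinUhlenbeck

variable {H : Type*} [NormedAddCommGroup H] [InnerProductSpace ℝ H] [CompleteSpace H]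
  [SecondCountableTopology H] {S : C0Semigroup H} {Q : H →L[ℝ] H} {δ C : ℝ}

theorem IsSmoothing.sqrtOp_Lam (hS : IsSmoothing S Q δ C) {t : ℝ} (ht : 0 < t) (h : H) :
    sqrtOp (covOp S Q t) (Lam S Q t h) = S.op t h :=
  Function.invFun_eq (hS.range_subset t ht ⟨h, rfl⟩)

/-- `Lam` is defined pointwise through a choice of preimages; injectivity of `Q_t^{1/2}` is what
makes it linear. -/
theorem IsSmoothing.exists_continuousLinearMap (hS : IsSmoothing S Q δ C) {t : ℝ} (ht : 0 < t) :
    ∃ Λ : H →L[ℝ] H, (∀ h, sqrtOp (covOp S Q t) (Λ h) = S.op t h) ∧ ‖Λ‖ ≤ C / t ^ δ := by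
  have hinj := sqrtOp_covOp_injective S hS.isPositive hS.ker_eq_zero ht
  let L : H →ₗ[ℝ] H :=
    { toFun := Lam S Q t
      map_add' := fun x y => hinj (by
        rw [map_add, hS.sqrtOp_Lam ht, hS.sqrtOp_Lam ht, hS.sqrtOp_Lam ht, map_add])
      map_smul' := fun c x => hinj (by
        rw [RingHom.id_apply, map_smul, hS.sqrtOp_Lam ht, hS.sqrtOp_Lam ht, map_smul]) }
  have hC := hS.const_pos
  exact ⟨L.mkContinuous (C / t ^ δ) (hS.norm_Lam_le t ht), hS.sqrtOp_Lam ht,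
    L.mkContinuous_norm_le (by positivity) _⟩

variable [MeasurableSpace H] [BorelSpace H]

omit [CompleteSpace H] [SecondCountableTopology H] in
theorem C0Semigroup.measurable_op (S : C0Semigroup H) :
    Measurable fun p : ℝ × H => S.op (max p.1 0) p.2 :=
  measurable_uncurry_of_continuous_of_measurable (u := fun t x => S.op (max t 0) x)
    S.continuous_orbit fun _ => (ContinuousLinearMap.continuous _).measurable

theorem IsSmoothing.isProbabilityMeasure (hS : IsSmoothing S Q δ C) (t : ℝ) :
    IsProbabilityMeasure (centredGaussian (covOp S Q t)) := by
  have := isGaussian_centredGaussian (covOp_isPositive S hS.isPositive t)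
    (hasFiniteTrace_covOp S hS.hasFiniteTrace t)
  infer_instance

theorem IsSmoothing.measurable_centredGaussian (hS : IsSmoothing S Q δ C) :
    Measurable fun t => centredGaussian (covOp S Q t) := by
  have := hS.isProbabilityMeasure
  refine measurable_of_continuous_charFun fun y => ?_
  have : (fun t => charFun (centredGaussian (covOp S Q t)) y)
      = fun t => Complex.exp (-((inner ℝ (covOp S Q t y) y / 2 : ℝ) : ℂ)) := by
    ext t
    exact charFun_centredGaussian (covOp_isPositive S hS.isPositive t)
      (hasFiniteTrace_covOp S hS.hasFiniteTrace t) y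
  rw [this]
  have h := continuous_inner_covOp S Q y y
  fun_prop

theorem IsSmoothing.measurable_ouSemigroup (hS : IsSmoothing S Q δ C) {φ : ℝ → H → ℝ}
    (hφ : Measurable (Function.uncurry φ)) : Measurable fun p : (ℝ × H) × ℝ =>
      ouSemigroup S Q (max (p.1.1 - p.2) 0) (φ p.2) p.1.2 := by
  let κ : Kernel ((ℝ × H) × ℝ) H :=
    ⟨fun p => centredGaussian (covOp S Q (max (p.1.1 - p.2) 0)),
      hS.measurable_centredGaussian.comp (by fun_prop)⟩
  have : IsMarkovKernel κ := ⟨fun p => hS.isProbabilityMeasure _⟩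
  have hm : Measurable fun q : ((ℝ × H) × ℝ) × H =>
      φ q.1.2 (S.op (max (q.1.1.1 - q.1.2) 0) q.1.1.2 + q.2) := by
    have h1 : Measurable fun q : ((ℝ × H) × ℝ) × H =>
        S.op (max (q.1.1.1 - q.1.2) 0) q.1.1.2 :=
      S.measurable_op.comp (g := fun p : ℝ × H => S.op (max p.1 0) p.2)
        (f := fun q : ((ℝ × H) × ℝ) × H => (q.1.1.1 - q.1.2, q.1.1.2)) (by fun_prop)
    exact hφ.comp (g := Function.uncurry φ)
      (f := fun q : ((ℝ × H) × ℝ) × H => (q.1.2, S.op (max (q.1.1.1 - q.1.2) 0) q.1.1.2 + q.2))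
      (by fun_prop)
  exact (hm.stronglyMeasurable.integral_kernel_prod_right' (κ := κ)).measurable

theorem IsSmoothing.abs_ouSemigroup_le (hS : IsSmoothing S Q δ C) (t : ℝ) {f : H → ℝ} {K : ℝ}
    (hf : ∀ x, |f x| ≤ K) (x : H) : |ouSemigroup S Q t f x| ≤ K := by
  have := hS.isProbabilityMeasure t
  have := norm_integral_le_of_norm_le_const (μ := centredGaussian (covOp S Q t))
    (f := fun y => f (S.op t x + y)) (Eventually.of_forall fun y => hf _)
  simpa [ouSemigroup] using this

theorem IsSmoothing.ouSemigroup_zero (hS : IsSmoothing S Q δ C) {f : H → ℝ} (x : H) :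
    ouSemigroup S Q 0 f x = f x := by
  have := hS.isProbabilityMeasure 0
  have h : centredGaussian (covOp S Q 0) = Measure.dirac 0 := by
    refine Measure.ext_of_charFun (funext fun y => ?_)
    rw [charFun_centredGaussian (covOp_isPositive S hS.isPositive 0)
      (hasFiniteTrace_covOp S hS.hasFiniteTrace 0), charFun_dirac, covOp_of_nonpos S Q le_rfl]
    simp
  rw [ouSemigroup, h, integral_dirac, S.op_zero]
  simp

theorem IsSmoothing.integrable_shift (hS : IsSmoothing S Q δ C) (t : ℝ) {f : H → ℝ}
    (hf : Measurable f) {K : ℝ} (hfK : ∀ x, |f x| ≤ K) (x : H) :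
    Integrable (fun y => f (S.op t x + y)) (centredGaussian (covOp S Q t)) := by
  have := hS.isProbabilityMeasure t
  exact Integrable.of_bound (hf.comp (measurable_const_add _)).aestronglyMeasurable K
    (Eventually.of_forall fun y => hfK _)

theorem IsSmoothing.ouSemigroup_sub (hS : IsSmoothing S Q δ C) (t : ℝ) {f g : H → ℝ}
    (hf : Measurable f) {K : ℝ} (hfK : ∀ x, |f x| ≤ K) (hg : Measurable g) {K' : ℝ}
    (hgK : ∀ x, |g x| ≤ K') (x : H) :
    ouSemigroup S Q t (fun y => f y - g y) x = ouSemigroup S Q t f x - ouSemigroup S Q t g x :=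
  integral_sub (hS.integrable_shift t hf hfK x) (hS.integrable_shift t hg hgK x)

theorem IsSmoothing.hasSum_ouSemigroup (hS : IsSmoothing S Q δ C) (t : ℝ) {f : ℕ → H → ℝ}
    {g : H → ℝ} (hf : ∀ n, Measurable (f n)) {a : ℕ → ℝ} (hfa : ∀ n x, |f n x| ≤ a n)
    (ha : Summable a) (hg : ∀ x, HasSum (fun n => f n x) (g x)) (x : H) :
    HasSum (fun n => ouSemigroup S Q t (f n) x) (ouSemigroup S Q t g x) := by
  have := hS.isProbabilityMeasure t
  exact hasSum_integral_of_dominated_convergence (fun n _ => a n)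
    (fun n => ((hf n).comp (measurable_const_add _)).aestronglyMeasurable)
    (fun n => Eventually.of_forall fun y => hfa n _) (Eventually.of_forall fun _ => ha)
    (integrable_const _) (Eventually.of_forall fun y => hg _)

/-- Factor `S_t f = g ∘ Λ(t)` with `g` the Gaussian average of `f` along `Q_t^{1/2}`. The chain rule
multiplies `‖Dg‖ ≤ K` by `‖Λ(t)‖ ≤ C t^{-δ}`. -/
theorem IsSmoothing.contDiff_ouSemigroup (hS : IsSmoothing S Q δ C) {t : ℝ} (ht : 0 < t)
    {f : H → ℝ} (hf : Measurable f) {K : ℝ} (hfK : ∀ x, |f x| ≤ K) :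
    ContDiff ℝ 1 (ouSemigroup S Q t f) ∧
      ∀ x, ‖fderiv ℝ (ouSemigroup S Q t f) x‖ ≤ K * (C / t ^ δ) := by
  obtain ⟨Λ, hΛ, hΛn⟩ := hS.exists_continuousLinearMap ht
  obtain ⟨h1, h2⟩ := contDiff_integral_centredGaussian (covOp_isPositive S hS.isPositive t)
    (hS.hasFiniteTrace t ht) hf hfK
  set g : H → ℝ := fun z => ∫ y, f (sqrtOp (covOp S Q t) z + y) ∂(centredGaussian (covOp S Q t))
    with hg
  have hK : 0 ≤ K := (abs_nonneg _).trans (hfK 0)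
  have e : ouSemigroup S Q t f = g ∘ Λ := by
    ext x
    simp only [hg, Function.comp_apply, hΛ]
    rfl
  rw [e]
  refine ⟨h1.comp Λ.contDiff, fun x => ?_⟩
  rw [fderiv_comp x ((h1.differentiable one_ne_zero) _) Λ.differentiableAt, Λ.fderiv]
  exact (ContinuousLinearMap.opNorm_comp_le _ _).trans (mul_le_mul (h2 _) hΛn (norm_nonneg _) hK)

theorem IsSmoothing.abs_ouSemigroup_sub_le (hS : IsSmoothing S Q δ C) {t : ℝ} (ht : 0 < t)
    {f : H → ℝ} (hf : Measurable f) {K : ℝ} (hfK : ∀ x, |f x| ≤ K) (x y : H) :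
    |ouSemigroup S Q t f x - ouSemigroup S Q t f y| ≤ K * (C / t ^ δ) * ‖x - y‖ := by
  obtain ⟨h1, h2⟩ := hS.contDiff_ouSemigroup ht hf hfK
  exact (convex_univ).norm_image_sub_le_of_norm_fderiv_le (𝕜 := ℝ)
    (fun z _ => (h1.differentiable one_ne_zero) z) (fun z _ => h2 z) (mem_univ y) (mem_univ x)

end OrnsteinUhlenbeck

/-! ### A weighted Beta-type integral -/

theorem integrableOn_rpow_mul_exp_neg {δ l : ℝ} (hδ : δ < 1) (hl : 0 < l) :
    IntegrableOn (fun r : ℝ => r ^ (-δ) * Real.exp (-(l * r))) (Ioi 0) := by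
  have h := integrableOn_rpow_mul_exp_neg_mul_rpow (p := 1) (s := -δ) (by linarith) one_pos hl
  simpa [neg_mul] using h

theorem integral_rpow_mul_exp_neg {δ l : ℝ} (hδ : δ < 1) (hl : 0 < l) :
    ∫ r in Ioi (0 : ℝ), r ^ (-δ) * Real.exp (-(l * r)) = (1 / l) ^ (1 - δ) * Real.Gamma (1 - δ) := by
  rw [← Real.integral_rpow_mul_exp_neg_mul_Ioi (a := 1 - δ) (by linarith) hl]
  simp

/-- The integral equals `l^{δ-1} Γ(1-δ)`, which tends to `0` as `l → ∞` because `δ < 1`. -/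
theorem exists_integral_rpow_mul_exp_neg_le {δ ε : ℝ} (hδ : δ < 1) (hε : 0 < ε) :
    ∃ l : ℝ, 0 < l ∧ ∫ r in Ioi (0 : ℝ), r ^ (-δ) * Real.exp (-(l * r)) ≤ ε := by
  have h1 : Tendsto (fun l : ℝ => (1 / l) ^ (1 - δ) * Real.Gamma (1 - δ)) atTop (𝓝 0) := by
    have h2 : Tendsto (fun l : ℝ => (1 / l) ^ (1 - δ)) atTop (𝓝 0) := by
      have := tendsto_rpow_neg_atTop (y := 1 - δ) (by linarith)
      refine this.congr' ?_
      filter_upwards [eventually_gt_atTop 0] with l hl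
      rw [one_div, Real.inv_rpow hl.le, Real.rpow_neg hl.le]
    simpa using h2.mul_const (Real.Gamma (1 - δ))
  obtain ⟨l, h2, h3⟩ := ((h1.eventually_lt_const hε).and (eventually_gt_atTop 0)).exists
  exact ⟨l, h3, (integral_rpow_mul_exp_neg hδ h3).trans_le h2.le⟩

/-- The weight `s ↦ s^{-δ} e^{l s}`. -/
noncomputable def weight (δ l s : ℝ) : ℝ := s ^ (-δ) * Real.exp (l * s)

theorem weight_nonneg (δ l : ℝ) {s : ℝ} (hs : 0 ≤ s) : 0 ≤ weight δ l s := by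
  unfold weight; positivity

theorem intervalIntegrable_weight {δ : ℝ} (hδ : δ < 1) (l a b : ℝ) :
    IntervalIntegrable (weight δ l) volume a b :=
  (intervalIntegral.intervalIntegrable_rpow' (by linarith)).mul_continuousOn (by fun_prop)

/-- Split at `s = t/2`: one of `s`, `t - s` is at least `t/2`, and its power is at most `2^δ
t^{-δ}`. The other singularity keeps an exponential decay, since `e^{ls} = e^{lt} e^{-l(t-s)}` and,
for `s ≤ t/2`, `e^{ls} ≤ e^{lt} e^{-ls}`. -/
theorem rpow_mul_weight_le {δ l s t : ℝ} (hδ : 0 < δ) (hl : 0 < l) (hs : 0 < s) (hst : s < t) :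
    (t - s) ^ (-δ) * weight δ l s ≤ 2 ^ δ * weight δ l t *
      (s ^ (-δ) * Real.exp (-(l * s)) + (t - s) ^ (-δ) * Real.exp (-(l * (t - s)))) := by
  have ht : 0 < t := hs.trans hst
  have hts : 0 < t - s := sub_pos.2 hst
  have e1 : 2 ^ δ * weight δ l t = (t / 2) ^ (-δ) * Real.exp (l * t) := by
    rw [weight, Real.div_rpow ht.le (by norm_num), Real.rpow_neg (by norm_num : (0:ℝ) ≤ 2)]
    field_simp
  have e2 : Real.exp (l * s) = Real.exp (l * t) * Real.exp (-(l * (t - s))) := by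
    rw [← Real.exp_add]; ring_nf
  rw [e1]
  unfold weight
  have p1 : 0 ≤ s ^ (-δ) := by positivity
  have p2 : 0 ≤ (t - s) ^ (-δ) := by positivity
  rcases le_total s (t / 2) with h | h
  · have h1 : (t - s) ^ (-δ) ≤ (t / 2) ^ (-δ) :=
      Real.rpow_le_rpow_of_nonpos (by linarith) (by linarith) (by linarith)
    have h2 : Real.exp (l * s) ≤ Real.exp (l * t) * Real.exp (-(l * s)) := by
      rw [← Real.exp_add]
      exact Real.exp_le_exp.2 (by nlinarith)
    calc (t - s) ^ (-δ) * (s ^ (-δ) * Real.exp (l * s))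
        ≤ (t / 2) ^ (-δ) * (s ^ (-δ) * (Real.exp (l * t) * Real.exp (-(l * s)))) := by gcongr
      _ = (t / 2) ^ (-δ) * Real.exp (l * t) * (s ^ (-δ) * Real.exp (-(l * s)) + 0) := by ring
      _ ≤ _ := by gcongr; positivity
  · have h1 : s ^ (-δ) ≤ (t / 2) ^ (-δ) :=
      Real.rpow_le_rpow_of_nonpos (by linarith) (by linarith) (by linarith)
    rw [e2]
    calc (t - s) ^ (-δ) * (s ^ (-δ) * (Real.exp (l * t) * Real.exp (-(l * (t - s)))))
        ≤ (t - s) ^ (-δ) * ((t / 2) ^ (-δ) * (Real.exp (l * t) * Real.exp (-(l * (t - s))))) := by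
          gcongr
      _ = (t / 2) ^ (-δ) * Real.exp (l * t) *
          (0 + (t - s) ^ (-δ) * Real.exp (-(l * (t - s)))) := by ring
      _ ≤ _ := by gcongr; positivity

theorem integral_rpow_mul_weight_le {δ l t : ℝ} (hδ0 : 0 < δ) (hδ : δ < 1) (hl : 0 < l)
    (ht : 0 < t) :
    IntervalIntegrable (fun s => (t - s) ^ (-δ) * weight δ l s) volume 0 t ∧
    ∫ s in (0 : ℝ)..t, (t - s) ^ (-δ) * weight δ l s ≤
      4 * (∫ r in Ioi (0 : ℝ), r ^ (-δ) * Real.exp (-(l * r))) * weight δ l t := by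
  set φ : ℝ → ℝ := fun r => r ^ (-δ) * Real.exp (-(l * r)) with hφ
  have i1 : IntervalIntegrable φ volume 0 t :=
    (intervalIntegrable_iff_integrableOn_Ioc_of_le ht.le).2
      ((integrableOn_rpow_mul_exp_neg hδ hl).mono_set Ioc_subset_Ioi_self)
  have i2 : IntervalIntegrable (fun s => φ (t - s)) volume 0 t := by
    simpa using (i1.comp_sub_left t).symm
  have i3 := (i1.add i2).const_mul (2 ^ δ * weight δ l t)
  have hle : ∀ s ∈ Ioo 0 t, (t - s) ^ (-δ) * weight δ l s ≤
      2 ^ δ * weight δ l t * (φ s + φ (t - s)) :=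
    fun s hs => rpow_mul_weight_le hδ0 hl hs.1 hs.2
  have i4 : IntervalIntegrable (fun s => (t - s) ^ (-δ) * weight δ l s) volume 0 t := by
    rw [intervalIntegrable_iff_integrableOn_Ioo_of_le ht.le] at i3 ⊢
    refine Integrable.mono' i3 ?_ ?_
    · unfold weight; exact Measurable.aestronglyMeasurable (by fun_prop)
    · refine (ae_restrict_iff' measurableSet_Ioo).2 (Eventually.of_forall fun s hs => ?_)
      rw [Real.norm_of_nonneg]
      · exact hle s hs
      · have := weight_nonneg δ l hs.1.le
        have : 0 ≤ t - s := (sub_pos.2 hs.2).le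
        positivity
  refine ⟨i4, (intervalIntegral.integral_mono_on_of_le_Ioo ht.le i4 i3 hle).trans ?_⟩
  have hφ0 : ∫ s in (0 : ℝ)..t, φ s ≤ ∫ r in Ioi (0 : ℝ), φ r := by
    rw [intervalIntegral.integral_of_le ht.le]
    refine setIntegral_mono_set (integrableOn_rpow_mul_exp_neg hδ hl) ?_
      (LE.le.eventuallyLE Ioc_subset_Ioi_self)
    refine (ae_restrict_iff' measurableSet_Ioi).2 (Eventually.of_forall fun s hs => ?_)
    have : (0 : ℝ) < s := hs
    simp only [hφ, Pi.zero_apply]; positivity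
  have hw := weight_nonneg δ l ht.le
  have h2 : (2 : ℝ) ^ δ ≤ 2 := by
    simpa using Real.rpow_le_rpow_of_exponent_le (x := 2) (by norm_num) hδ.le
  have hG : 0 ≤ ∫ r in Ioi (0 : ℝ), φ r := by
    refine setIntegral_nonneg measurableSet_Ioi fun s hs => ?_
    have : (0 : ℝ) < s := hs
    simp only [hφ]; positivity
  have e : ∫ s in (0 : ℝ)..t, (φ s + φ (t - s)) = 2 * ∫ s in (0 : ℝ)..t, φ s := by
    rw [intervalIntegral.integral_add i1 i2, intervalIntegral.integral_comp_sub_left]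
    simp [two_mul]
  rw [intervalIntegral.integral_const_mul]
  calc 2 ^ δ * weight δ l t * ∫ s in (0 : ℝ)..t, (φ s + φ (t - s))
      ≤ 2 * weight δ l t * (2 * ∫ r in Ioi (0 : ℝ), φ r) := by
        rw [e]
        -- The constant `4` comes from `2^δ ≤ 2` and from the two equal integrals of `φ(s)` and `φ(t
        -- - s)`.
        exact mul_le_mul_of_nonneg (by gcongr) (by linarith) (by positivity) (by positivity)
    _ = _ := by ring

/-- The smoothing kernel is a contraction for the weighted norm, for a large enough exponential
rate. -/
theorem exists_weight {δ : ℝ} (hδ0 : 0 < δ) (hδ : δ < 1) {ε : ℝ} (hε : 0 < ε) :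
    ∃ l : ℝ, 0 < l ∧ (∫ r in Ioi (0 : ℝ), r ^ (-δ) * Real.exp (-(l * r)) ≤ ε) ∧ ∀ t : ℝ, 0 < t →
      IntervalIntegrable (fun s => (t - s) ^ (-δ) * weight δ l s) volume 0 t ∧
      ∫ s in (0 : ℝ)..t, (t - s) ^ (-δ) * weight δ l s ≤ ε * weight δ l t := by
  obtain ⟨l, hl, h⟩ := exists_integral_rpow_mul_exp_neg_le hδ (ε := ε / 4) (by positivity)
  refine ⟨l, hl, h.trans (by linarith), fun t ht => ?_⟩
  obtain ⟨h1, h2⟩ := integral_rpow_mul_weight_le hδ0 hδ hl ht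
  refine ⟨h1, h2.trans ?_⟩
  have := weight_nonneg δ l ht.le
  gcongr
  linarith

/-! ### The drift term and the mild operator -/

section MildOperator

variable {H : Type*} [NormedAddCommGroup H] [InnerProductSpace ℝ H]
  {B : H → H}

/-- Derivatives will be shown measurable as limits of difference quotients along the sequence
`1/(k+1)`. -/
theorem tendsto_difference_quotient {f : H → ℝ} {x : H} (hf : DifferentiableAt ℝ f x) (y : H) :
    Tendsto (fun k : ℕ => ((k : ℝ) + 1) * (f (x + ((k : ℝ) + 1)⁻¹ • y) - f x)) atTop
      (𝓝 (fderiv ℝ f x y)) := by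
  have h1 : Tendsto (fun k : ℕ => ((k : ℝ) + 1)) atTop atTop :=
    tendsto_atTop_add_const_right _ _ tendsto_natCast_atTop_atTop
  have h := hf.hasFDerivAt.lim_real y
  exact h.comp h1

theorem abs_drift_le {K : ℝ} (hBK : ∀ x, ‖B x‖ ≤ K) {f : H → ℝ} {x : H} {m : ℝ}
    (h : ‖fderiv ℝ f x‖ ≤ m) : |drift B f x| ≤ K * m := by
  have h1 := (fderiv ℝ f x).le_opNorm (B x)
  rw [Real.norm_eq_abs] at h1
  calc |drift B f x| ≤ ‖fderiv ℝ f x‖ * ‖B x‖ := h1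
    _ ≤ m * K := mul_le_mul h (hBK x) (norm_nonneg _) ((norm_nonneg _).trans h)
    _ = K * m := mul_comm _ _

/-- The Riesz isomorphism moves the derivative into the separable space `H`, where weak
measurability suffices; each directional derivative is a limit of difference quotients. -/
theorem aestronglyMeasurable_fderiv [CompleteSpace H] [SecondCountableTopology H] {α : Type*} [MeasurableSpace α] {μ : Measure α}
    {F : H → α → ℝ} (hF : ∀ x, AEStronglyMeasurable (F x) μ) {x : H}
    (hd : ∀ᵐ a ∂μ, DifferentiableAt ℝ (fun z => F z a) x) :
    AEStronglyMeasurable (fun a => fderiv ℝ (fun z => F z a) x) μ := by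
  have h : AEStronglyMeasurable
      (fun a => (InnerProductSpace.toDual ℝ H).symm (fderiv ℝ (fun z => F z a) x)) μ := by
    refine aestronglyMeasurable_of_inner fun y => ?_
    refine aestronglyMeasurable_of_tendsto_ae (u := atTop)
      (f := fun (k : ℕ) a => ((k : ℝ) + 1) * (F (x + ((k : ℝ) + 1)⁻¹ • y) a - F x a))
      (fun k => ((hF _).sub (hF _)).const_mul _) ?_
    filter_upwards [hd] with a ha
    rw [real_inner_comm, InnerProductSpace.toDual_symm_apply]
    exact tendsto_difference_quotient ha y
  have h2 := (InnerProductSpace.toDual ℝ H).continuous.comp_aestronglyMeasurable h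
  exact h2.congr (Eventually.of_forall fun a => by simp)

variable [MeasurableSpace H]

/-- Time-dependent functions which are jointly measurable and of class `C¹` in space at positive
times, with a derivative bounded by `m t` at time `t`. -/
structure IsRegular (v : ℝ → H → ℝ) (m : ℝ → ℝ) : Prop where
  measurable : Measurable fun p : ℝ × H => if 0 < p.1 then v p.1 p.2 else 0
  contDiff : ∀ t, 0 < t → ContDiff ℝ 1 (v t)
  norm_fderiv_le : ∀ t, 0 < t → ∀ x, ‖fderiv ℝ (v t) x‖ ≤ m t

theorem IsRegular.differentiable {v : ℝ → H → ℝ} {m : ℝ → ℝ} (hv : IsRegular v m) {t : ℝ}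
    (ht : 0 < t) : Differentiable ℝ (v t) :=
  (hv.contDiff t ht).differentiable one_ne_zero

theorem IsRegular.mono {v : ℝ → H → ℝ} {m m' : ℝ → ℝ} (hv : IsRegular v m)
    (h : ∀ t, 0 < t → m t ≤ m' t) : IsRegular v m' :=
  ⟨hv.measurable, hv.contDiff, fun t ht x => (hv.norm_fderiv_le t ht x).trans (h t ht)⟩

variable [BorelSpace H] [SecondCountableTopology H]

theorem measurable_drift (hB : Measurable B) {f : H → ℝ} (hf : Differentiable ℝ f) :
    Measurable (drift B f) := by
  have hc := hf.continuous.measurable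
  refine measurable_of_tendsto_metrizable
    (f := fun (k : ℕ) x => ((k : ℝ) + 1) * (f (x + ((k : ℝ) + 1)⁻¹ • B x) - f x))
    (fun k => ?_) (tendsto_pi_nhds.2 fun x => tendsto_difference_quotient (hf x) (B x))
  exact ((hc.comp (by fun_prop : Measurable fun x => x + ((k : ℝ) + 1)⁻¹ • B x)).sub hc).const_mul _

theorem IsRegular.measurable_drift (hB : Measurable B) {v : ℝ → H → ℝ} {m : ℝ → ℝ}
    (hv : IsRegular v m) :
    Measurable (Function.uncurry fun (s : ℝ) (x : H) => if 0 < s then drift B (v s) x else 0) := by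
  refine measurable_of_tendsto_metrizable
    (f := fun (k : ℕ) (p : ℝ × H) => ((k : ℝ) + 1) *
      ((if 0 < p.1 then v p.1 (p.2 + ((k : ℝ) + 1)⁻¹ • B p.2) else 0) -
        (if 0 < p.1 then v p.1 p.2 else 0))) (fun k => ?_) (tendsto_pi_nhds.2 fun p => ?_)
  · refine (Measurable.sub ?_ hv.measurable).const_mul _
    exact hv.measurable.comp
      (by fun_prop : Measurable fun p : ℝ × H => (p.1, p.2 + ((k : ℝ) + 1)⁻¹ • B p.2))
  · by_cases h : 0 < p.1
    · simpa [Function.uncurry, h, drift] using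
        tendsto_difference_quotient (hv.differentiable h p.2) (B p.2)
    · simp [Function.uncurry, h]

variable [CompleteSpace H] {S : C0Semigroup H} {Q : H →L[ℝ] H} {δ C K : ℝ} {v : ℝ → H → ℝ}
  {m : ℝ → ℝ}

theorem IsSmoothing.measurable_mildIntegrand (hS : IsSmoothing S Q δ C) (hB : Measurable B)
    (hv : IsRegular v m) : Measurable fun p : (ℝ × H) × ℝ =>
      if 0 < p.2 ∧ p.2 < p.1.1 then mildIntegrand S Q B v p.1.1 p.1.2 p.2 else 0 := by
  have h := hS.measurable_ouSemigroup (hv.measurable_drift hB)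
  have hs : MeasurableSet {p : (ℝ × H) × ℝ | 0 < p.2 ∧ p.2 < p.1.1} :=
    (measurableSet_lt measurable_const measurable_snd).inter
      (measurableSet_lt measurable_snd (measurable_fst.comp measurable_fst))
  convert h.indicator hs using 2 with p
  by_cases hp : 0 < p.2 ∧ p.2 < p.1.1
  · simp [mildIntegrand, hp, max_eq_left (sub_pos.2 hp.2).le]
  · simp [hp]

theorem IsSmoothing.aestronglyMeasurable_mildIntegrand (hS : IsSmoothing S Q δ C)
    (hB : Measurable B) (hv : IsRegular v m) (t : ℝ) (x : H) :
    AEStronglyMeasurable (mildIntegrand S Q B v t x) (volume.restrict (Ioo 0 t)) := by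
  have h := ((hS.measurable_mildIntegrand hB hv).comp
    (by fun_prop : Measurable fun s : ℝ => ((t, x), s))).aestronglyMeasurable
      (μ := volume.restrict (Ioo 0 t))
  refine h.congr ((ae_restrict_iff' measurableSet_Ioo).2 (Eventually.of_forall fun s hs => ?_))
  simp [hs.1, hs.2]

theorem IsSmoothing.abs_mildIntegrand_le (hS : IsSmoothing S Q δ C)
    (hBK : ∀ x, ‖B x‖ ≤ K) (hv : IsRegular v m) (t : ℝ) (x : H) {s : ℝ} (hs : 0 < s) :
    |mildIntegrand S Q B v t x s| ≤ K * m s :=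
  hS.abs_ouSemigroup_le _ (fun y => abs_drift_le hBK (hv.norm_fderiv_le s hs y)) x

theorem IsSmoothing.integrableOn_mildIntegrand (hS : IsSmoothing S Q δ C) (hB : Measurable B)
    (hBK : ∀ x, ‖B x‖ ≤ K) (hv : IsRegular v m) {t : ℝ} (hm : IntegrableOn m (Ioo 0 t)) (x : H) :
    IntegrableOn (mildIntegrand S Q B v t x) (Ioo 0 t) :=
  Integrable.mono' (hm.const_mul K) (hS.aestronglyMeasurable_mildIntegrand hB hv t x)
    ((ae_restrict_iff' measurableSet_Ioo).2 (Eventually.of_forall fun _ hs =>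
      hS.abs_mildIntegrand_le hBK hv t x hs.1))

theorem IsSmoothing.abs_integral_mildIntegrand_le (hS : IsSmoothing S Q δ C)
    (hBK : ∀ x, ‖B x‖ ≤ K) (hv : IsRegular v m) {t : ℝ} (ht : 0 < t)
    (hm : IntervalIntegrable m volume 0 t) (x : H) :
    |∫ s in (0 : ℝ)..t, mildIntegrand S Q B v t x s| ≤ K * ∫ s in (0 : ℝ)..t, m s := by
  rw [← intervalIntegral.integral_const_mul]
  exact intervalIntegral.norm_integral_le_of_norm_le (f := mildIntegrand S Q B v t x) ht.le
    (Eventually.of_forall fun s hs => hS.abs_mildIntegrand_le hBK hv t x hs.1) (hm.const_mul K)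

/-- The mild operator preserves regularity. -/
theorem IsSmoothing.isRegular_integral (hS : IsSmoothing S Q δ C) (hB : Measurable B)
    (hBK : ∀ x, ‖B x‖ ≤ K) (hv : IsRegular v m)
    (hm : ∀ t, 0 < t → IntervalIntegrable m volume 0 t)
    (hm' : ∀ t, 0 < t → IntervalIntegrable (fun s => (t - s) ^ (-δ) * m s) volume 0 t) :
    IsRegular (fun t x => ∫ s in (0 : ℝ)..t, mildIntegrand S Q B v t x s)
      (fun t => K * C * ∫ s in (0 : ℝ)..t, (t - s) ^ (-δ) * m s) := by
  -- The smoothing estimate over the time `t - s`, applied to the drift bounded by `K m(s)`. The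
  -- resulting integrable majorant serves both differentiation under the integral and continuity of
  -- the derivative.
  have key : ∀ t, 0 < t → ∀ x s, s ∈ Ioo 0 t →
      ContDiff ℝ 1 (fun x => mildIntegrand S Q B v t x s) ∧
      ‖fderiv ℝ (fun x => mildIntegrand S Q B v t x s) x‖ ≤ K * C * ((t - s) ^ (-δ) * m s) := by
    intro t ht x s hs
    obtain ⟨h1, h2⟩ := hS.contDiff_ouSemigroup (sub_pos.2 hs.2)
      (MildKolmogorov.measurable_drift hB (hv.differentiable hs.1))
      (fun y => abs_drift_le hBK (hv.norm_fderiv_le s hs.1 y))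
    refine ⟨h1, (h2 x).trans (le_of_eq ?_)⟩
    rw [Real.rpow_neg (sub_pos.2 hs.2).le]
    ring
  have hder : ∀ t, 0 < t → ∀ x, HasFDerivAt
      (fun x => ∫ s in (0 : ℝ)..t, mildIntegrand S Q B v t x s)
      (∫ s in Ioo 0 t, fderiv ℝ (fun x => mildIntegrand S Q B v t x s) x) x := by
    intro t ht x
    simp only [intervalIntegral.integral_of_le ht.le, integral_Ioc_eq_integral_Ioo]
    refine hasFDerivAt_integral_of_dominated_of_fderiv_le (s := univ)
      (F' := fun x s => fderiv ℝ (fun x => mildIntegrand S Q B v t x s) x)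
      (bound := fun s => K * C * ((t - s) ^ (-δ) * m s)) univ_mem
      (Eventually.of_forall fun y => hS.aestronglyMeasurable_mildIntegrand hB hv t y)
      (hS.integrableOn_mildIntegrand hB hBK hv
        ((intervalIntegrable_iff_integrableOn_Ioo_of_le ht.le).1 (hm t ht)) x)
      (aestronglyMeasurable_fderiv
        (fun y => hS.aestronglyMeasurable_mildIntegrand hB hv t y) ?_) ?_
      (((intervalIntegrable_iff_integrableOn_Ioo_of_le ht.le).1 (hm' t ht)).const_mul _) ?_
    · exact (ae_restrict_iff' measurableSet_Ioo).2 (Eventually.of_forall fun s hs =>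
        (key t ht x s hs).1.differentiable one_ne_zero x)
    · exact (ae_restrict_iff' measurableSet_Ioo).2 (Eventually.of_forall fun s hs y _ =>
        (key t ht y s hs).2)
    · exact (ae_restrict_iff' measurableSet_Ioo).2 (Eventually.of_forall fun s hs y _ =>
        ((key t ht y s hs).1.differentiable one_ne_zero y).hasFDerivAt)
  refine ⟨?_, fun t ht => ?_, fun t ht x => ?_⟩
  · have h := (hS.measurable_mildIntegrand hB hv).stronglyMeasurable.integral_prod_right'
      (ν := volume)
    convert h.measurable using 2 with p
    by_cases hp : 0 < p.1
    · rw [if_pos hp, intervalIntegral.integral_of_le hp.le, integral_Ioc_eq_integral_Ioo,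
        ← integral_indicator measurableSet_Ioo]
      refine integral_congr_ae (Eventually.of_forall fun s => ?_)
      simp [indicator_apply]
    · rw [if_neg hp]
      refine (integral_eq_zero_of_ae (Eventually.of_forall fun s => ?_)).symm
      exact if_neg fun h => hp (h.1.trans h.2)
  · refine contDiff_one_iff_fderiv.2 ⟨fun x => (hder t ht x).differentiableAt, ?_⟩
    rw [show fderiv ℝ (fun x => ∫ s in (0 : ℝ)..t, mildIntegrand S Q B v t x s) =
      fun x => ∫ s in Ioo 0 t, fderiv ℝ (fun x => mildIntegrand S Q B v t x s) x from
      funext fun x => (hder t ht x).fderiv]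
    refine continuous_of_dominated (bound := fun s => K * C * ((t - s) ^ (-δ) * m s))
      (fun x => aestronglyMeasurable_fderiv
        (fun y => hS.aestronglyMeasurable_mildIntegrand hB hv t y) ?_) (fun x => ?_)
      (((intervalIntegrable_iff_integrableOn_Ioo_of_le ht.le).1 (hm' t ht)).const_mul _) ?_
    · exact (ae_restrict_iff' measurableSet_Ioo).2 (Eventually.of_forall fun s hs =>
        (key t ht x s hs).1.differentiable one_ne_zero x)
    · exact (ae_restrict_iff' measurableSet_Ioo).2 (Eventually.of_forall fun s hs =>
        (key t ht x s hs).2)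
    · exact (ae_restrict_iff' measurableSet_Ioo).2 (Eventually.of_forall fun s hs =>
        (key t ht 0 s hs).1.continuous_fderiv one_ne_zero)
  · rw [(hder t ht x).fderiv, intervalIntegral.integral_of_le ht.le, integral_Ioc_eq_integral_Ioo,
      ← integral_const_mul]
    refine norm_integral_le_of_norm_le
      (((intervalIntegrable_iff_integrableOn_Ioo_of_le ht.le).1 (hm' t ht)).const_mul _) ?_
    exact (ae_restrict_iff' measurableSet_Ioo).2 (Eventually.of_forall fun s hs =>
      (key t ht x s hs).2)

end MildOperator

/-! ### The iteration and its sum -/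

section Iteration

variable {H : Type*} [NormedAddCommGroup H] [InnerProductSpace ℝ H]

theorem supNormD_le {f : H → ℝ} {m : ℝ} (h : ∀ x, ‖fderiv ℝ f x‖ ≤ m) : supNormD f ≤ m :=
  ciSup_le h

theorem supNormD_nonneg (f : H → ℝ) : 0 ≤ supNormD f :=
  Real.iSup_nonneg fun _ => norm_nonneg _

theorem norm_fderiv_le_supNormD {f : H → ℝ} (hf : IsCb1 f) (x : H) :
    ‖fderiv ℝ f x‖ ≤ supNormD f := by
  obtain ⟨m, hm⟩ := hf.2.2
  exact le_ciSup (f := fun x => ‖fderiv ℝ f x‖) ⟨m, by rintro _ ⟨y, rfl⟩; exact hm y⟩ x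

variable [MeasurableSpace H]

theorem IsRegular.aestronglyMeasurable {v : ℝ → H → ℝ} {m : ℝ → ℝ} (hv : IsRegular v m) (T : ℝ)
    (x : H) : AEStronglyMeasurable (fun t => v t x) (volume.restrict (Ioc 0 T)) := by
  have h := (hv.measurable.comp (by fun_prop : Measurable fun t : ℝ => (t, x))).aestronglyMeasurable
    (μ := volume.restrict (Ioc 0 T))
  refine h.congr ((ae_restrict_iff' measurableSet_Ioc).2 (Eventually.of_forall fun s hs => ?_))
  simp [hs.1]

variable [CompleteSpace H] [SecondCountableTopology H]

/-- Measurability is the only issue: since the derivative is continuous in space, the supremum may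
be taken over a countable dense set. -/
theorem IsRegular.integrableOn_supNormD {v : ℝ → H → ℝ} {m : ℝ → ℝ} (hv : IsRegular v m) {T : ℝ}
    (hm : IntegrableOn m (Ioc 0 T)) : IntegrableOn (fun t => supNormD (v t)) (Ioc 0 T) := by
  obtain ⟨D, hDc, hD⟩ := TopologicalSpace.exists_countable_dense H
  have : Countable D := hDc.to_subtype
  refine Integrable.mono' hm ?_ ?_
  · have h : AEMeasurable (fun t => ⨆ x : D, ‖fderiv ℝ (v t) x‖) (volume.restrict (Ioc 0 T)) := by
      refine AEMeasurable.iSup fun x => ?_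
      refine (aestronglyMeasurable_fderiv (F := fun x t => v t x)
        (fun y => hv.aestronglyMeasurable T y) ?_).norm.aemeasurable
      exact (ae_restrict_iff' measurableSet_Ioc).2
        (Eventually.of_forall fun t ht => hv.differentiable ht.1 _)
    refine (h.congr ((ae_restrict_iff' measurableSet_Ioc).2
      (Eventually.of_forall fun t ht => ?_))).aestronglyMeasurable
    exact hD.ciSup' (((hv.contDiff t ht.1).continuous_fderiv one_ne_zero).norm)
  · refine (ae_restrict_iff' measurableSet_Ioc).2 (Eventually.of_forall fun t ht => ?_)
    rw [Real.norm_of_nonneg (supNormD_nonneg _)]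
    exact supNormD_le (hv.norm_fderiv_le t ht.1)

variable [BorelSpace H]
  {S : C0Semigroup H} {Q : H →L[ℝ] H} {δ C K M : ℝ} {B : H → H} {u₀ : H → ℝ}

theorem IsSmoothing.isRegular_ouSemigroup (hS : IsSmoothing S Q δ C) (hu₀ : Measurable u₀)
    (hM : ∀ x, |u₀ x| ≤ M) : IsRegular (fun t => ouSemigroup S Q t u₀) fun t => M * (C / t ^ δ) := by
  refine ⟨?_, fun t ht => (hS.contDiff_ouSemigroup ht hu₀ hM).1,
    fun t ht => (hS.contDiff_ouSemigroup ht hu₀ hM).2⟩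
  have h := (hS.measurable_ouSemigroup (φ := fun _ => u₀) (hu₀.comp measurable_snd)).comp
    (by fun_prop : Measurable fun p : ℝ × H => (p, (0 : ℝ)))
  convert h.indicator (measurableSet_lt measurable_const measurable_fst :
    MeasurableSet {p : ℝ × H | 0 < p.1}) using 2 with p
  by_cases hp : 0 < p.1
  · simp [hp, hp.le]
  · simp [hp]

/-- Bounds of the derivatives of the iterates, with geometric decay. -/
theorem IsSmoothing.exists_isRegular_iter (hS : IsSmoothing S Q δ C) (hB : Measurable B)
    (hK : 0 < K) (hBK : ∀ x, ‖B x‖ ≤ K) (hu₀ : Measurable u₀) (hM : ∀ x, |u₀ x| ≤ M) :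
    ∃ l A : ℝ, 0 ≤ A ∧ ∀ n, IsRegular (iter S Q B u₀ n) fun t => A * (1 / 2) ^ n * weight δ l t := by
  have hC := hS.const_pos
  have hM0 : 0 ≤ M := (abs_nonneg _).trans (hM 0)
  -- One step costs a factor `K C`, so this choice makes every iteration halve the weighted bound.
  obtain ⟨l, hl, -, h⟩ := exists_weight hS.exponent_pos hS.exponent_lt_one
    (ε := 1 / (2 * (K * C))) (by positivity)
  refine ⟨l, M * C, by positivity, fun n => ?_⟩
  induction n with
  | zero =>
    refine (hS.isRegular_ouSemigroup hu₀ hM).mono fun t ht => ?_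
    have h1 : 1 ≤ Real.exp (l * t) := Real.one_le_exp (by positivity)
    rw [weight, Real.rpow_neg ht.le]
    calc M * (C / t ^ δ) = M * C * (1 / 2) ^ 0 * ((t ^ δ)⁻¹ * 1) := by field_simp
      _ ≤ _ := by gcongr
  | succ n ih =>
    have h1 : ∀ t, 0 < t → IntervalIntegrable
        (fun s => (t - s) ^ (-δ) * (M * C * (1 / 2) ^ n * weight δ l s)) volume 0 t := by
      intro t ht
      refine ((h t ht).1.const_mul (M * C * (1 / 2) ^ n)).congr ?_
      exact fun s _ => by ring
    refine (hS.isRegular_integral hB hBK ih (fun t _ =>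
      (intervalIntegrable_weight hS.exponent_lt_one l 0 t).const_mul _) h1).mono fun t ht => ?_
    have e : ∀ s, (t - s) ^ (-δ) * (M * C * (1 / 2) ^ n * weight δ l s) =
        M * C * (1 / 2) ^ n * ((t - s) ^ (-δ) * weight δ l s) := fun s => by ring
    simp only [e, intervalIntegral.integral_const_mul]
    calc K * C * (M * C * (1 / 2) ^ n * ∫ s in (0 : ℝ)..t, (t - s) ^ (-δ) * weight δ l s)
        ≤ K * C * (M * C * (1 / 2) ^ n * (1 / (2 * (K * C)) * weight δ l t)) := by
          gcongr; exact (h t ht).2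
      _ = M * C * (1 / 2) ^ (n + 1) * weight δ l t := by field_simp; ring

variable {l A : ℝ}

/-- The derivative bounds are integrable in time, so the iterates themselves decay geometrically. In
the constant, `M` covers `n = 0`, and the factor `2` compensates the shift from `2^{-n}` to
`2^{-(n+1)}`. -/
theorem IsSmoothing.exists_abs_iter_le (hS : IsSmoothing S Q δ C)
    (hK : 0 ≤ K) (hBK : ∀ x, ‖B x‖ ≤ K) (hM : ∀ x, |u₀ x| ≤ M) (hA : 0 ≤ A)
    (h : ∀ n, IsRegular (iter S Q B u₀ n) fun t => A * (1 / 2) ^ n * weight δ l t) (T : ℝ) :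
    ∃ c : ℝ, ∀ n, ∀ t ∈ Icc 0 T, ∀ x, |iter S Q B u₀ n t x| ≤ c * (1 / 2) ^ n := by
  have hM0 : 0 ≤ M := (abs_nonneg _).trans (hM 0)
  set W : ℝ := ∫ s in Ioc 0 T, weight δ l s with hW
  have hWi (t : ℝ) : IntervalIntegrable (weight δ l) volume 0 t :=
    intervalIntegrable_weight hS.exponent_lt_one l 0 t
  have hw0 : 0 ≤ᵐ[volume.restrict (Ioc 0 T)] weight δ l :=
    (ae_restrict_iff' measurableSet_Ioc).2
      (Eventually.of_forall fun s hs => weight_nonneg δ l hs.1.le)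
  have hW0 : 0 ≤ W := integral_nonneg_of_ae hw0
  refine ⟨M + 2 * K * A * W, fun n t ht x => ?_⟩
  have hT : 0 ≤ T := ht.1.trans ht.2
  rcases n with _ | n
  · have := hS.abs_ouSemigroup_le t hM x
    have h2 : 0 ≤ 2 * K * A * W := by positivity
    simp only [iter, pow_zero, mul_one]
    linarith
  · have hle : |iter S Q B u₀ (n + 1) t x| ≤ K * (A * (1 / 2) ^ n * W) := by
      rcases ht.1.eq_or_lt with rfl | ht0
      · simp only [iter, intervalIntegral.integral_same, abs_zero]; positivity
      · refine (hS.abs_integral_mildIntegrand_le hBK (h n) ht0 ((hWi t).const_mul _) x).trans ?_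
        rw [intervalIntegral.integral_const_mul, intervalIntegral.integral_of_le ht0.le]
        gcongr
        exact setIntegral_mono_set ((intervalIntegrable_iff_integrableOn_Ioc_of_le hT).1 (hWi T))
          hw0 (LE.le.eventuallyLE (Ioc_subset_Ioc_right ht.2))
    refine hle.trans ?_
    have h2 : 0 ≤ M * (1 / 2) ^ (n + 1) := by positivity
    calc K * (A * (1 / 2) ^ n * W) ≤ K * (A * (1 / 2) ^ n * W) + M * (1 / 2) ^ (n + 1) := by linarith
      _ = _ := by ring

theorem summable_geometric_mul (c d : ℝ) : Summable fun n : ℕ => c * (1 / 2) ^ n * d :=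
  (summable_geometric_two.mul_left c).mul_right d

theorem tsum_geometric_mul (c d : ℝ) : ∑' n : ℕ, c * (1 / 2) ^ n * d = 2 * c * d := by
  rw [tsum_mul_right, tsum_mul_left, tsum_geometric_two]; ring

theorem iter_isCb1 (hreg : ∀ n, IsRegular (iter S Q B u₀ n) fun t => A * (1 / 2) ^ n * weight δ l t)
    (hbdd : ∀ T, ∃ c : ℝ, ∀ n, ∀ t ∈ Icc 0 T, ∀ x, |iter S Q B u₀ n t x| ≤ c * (1 / 2) ^ n)
    (n : ℕ) {t : ℝ} (ht : 0 < t) : IsCb1 (iter S Q B u₀ n t) := by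
  obtain ⟨c, hc⟩ := hbdd t
  exact ⟨(hreg n).differentiable ht, ⟨_, hc n t ⟨ht.le, le_rfl⟩⟩, _, (hreg n).norm_fderiv_le t ht⟩

/-! ### Convergence of the series and the mild equation for its sum -/

section Sum

variable (hreg : ∀ n, IsRegular (iter S Q B u₀ n) fun t => A * (1 / 2) ^ n * weight δ l t)
  (hbdd : ∀ T, ∃ c : ℝ, ∀ n, ∀ t ∈ Icc 0 T, ∀ x, |iter S Q B u₀ n t x| ≤ c * (1 / 2) ^ n)

include hbdd

theorem summable_iter {t : ℝ} (ht : 0 ≤ t) (x : H) : Summable fun n => iter S Q B u₀ n t x := by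
  obtain ⟨c, hc⟩ := hbdd t
  refine Summable.of_norm_bounded (summable_geometric_mul c 1) fun n => ?_
  simpa using hc n t ⟨ht, le_rfl⟩ x

theorem tendstoUniformlyOn_iter (T : ℝ) : TendstoUniformlyOn
    (fun (N : ℕ) (p : ℝ × H) => ∑ n ∈ Finset.range N, iter S Q B u₀ n p.1 p.2)
    (fun p => ∑' n, iter S Q B u₀ n p.1 p.2) atTop (Icc 0 T ×ˢ univ) := by
  obtain ⟨c, hc⟩ := hbdd T
  refine tendstoUniformlyOn_tsum_nat (summable_geometric_mul c 1) fun n p hp => ?_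
  simpa using hc n p.1 hp.1 p.2

include hreg

theorem hasSum_fderiv_iter {t : ℝ} (ht : 0 < t) (x : H) :
    HasSum (fun n => fderiv ℝ (iter S Q B u₀ n t) x)
      (fderiv ℝ (fun y => ∑' n, iter S Q B u₀ n t y) x) := by
  have hs := summable_geometric_mul A (weight δ l t)
  rw [fderiv_tsum_apply hs (fun n => (hreg n).differentiable ht)
    (fun n y => (hreg n).norm_fderiv_le t ht y) (summable_iter hbdd ht.le 0)]
  exact (Summable.of_norm_bounded hs fun n => (hreg n).norm_fderiv_le t ht x).hasSum

theorem isRegular_tsum_iter : IsRegular (fun t x => ∑' n, iter S Q B u₀ n t x)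
    fun t => 2 * A * weight δ l t := by
  refine ⟨?_, fun t ht => ?_, fun t ht x => ?_⟩
  · refine measurable_of_tendsto_metrizable (f := fun (N : ℕ) (p : ℝ × H) =>
      ∑ n ∈ Finset.range N, if 0 < p.1 then iter S Q B u₀ n p.1 p.2 else 0)
      (fun N => Finset.measurable_fun_sum _ fun n _ => (hreg n).measurable)
      (tendsto_pi_nhds.2 fun p => ?_)
    by_cases hp : 0 < p.1
    · simpa [hp] using (summable_iter hbdd hp.le p.2).hasSum.tendsto_sum_nat
    · simp [hp]
  · obtain ⟨c, hc⟩ := hbdd t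
    -- Order `0` is controlled by the bounds on the iterates, order `1` by the weighted bounds at
    -- the fixed time `t`.
    refine contDiff_tsum (N := 1) (v := fun k n => if k = 0 then c * (1 / 2) ^ n * 1 else
      A * (1 / 2) ^ n * weight δ l t) (fun n => (hreg n).contDiff t ht) ?_ ?_
    · intro k _
      rcases k with _ | k
      · simpa using summable_geometric_mul c 1
      · simpa using summable_geometric_mul A (weight δ l t)
    · intro k n x hk
      have hk1 : k ≤ 1 := by exact_mod_cast hk
      interval_cases k
      · simpa using hc n t ⟨ht.le, le_rfl⟩ x
      · rw [norm_iteratedFDeriv_one]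
        simpa using (hreg n).norm_fderiv_le t ht x
  · have h := hasSum_fderiv_iter hreg hbdd ht x
    rw [← h.tsum_eq, ← tsum_geometric_mul A]
    exact tsum_of_norm_bounded (summable_geometric_mul A (weight δ l t)).hasSum
      fun n => (hreg n).norm_fderiv_le t ht x

theorem IsSmoothing.hasSum_mildIntegrand_iter (hS : IsSmoothing S Q δ C) (hB : Measurable B)
    (hBK : ∀ x, ‖B x‖ ≤ K) (t : ℝ) {s : ℝ} (hs : 0 < s) (x : H) :
    HasSum (fun n => mildIntegrand S Q B (iter S Q B u₀ n) t x s)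
      (mildIntegrand S Q B (fun t x => ∑' n, iter S Q B u₀ n t x) t x s) :=
  hS.hasSum_ouSemigroup (t - s) (a := fun n => K * (A * (1 / 2) ^ n * weight δ l s))
    (fun n => measurable_drift hB ((hreg n).differentiable hs))
    (fun n y => abs_drift_le hBK ((hreg n).norm_fderiv_le s hs y))
    ((summable_geometric_mul A (weight δ l s)).mul_left K)
    (fun y => (ContinuousLinearMap.apply ℝ ℝ (B y)).hasSum (hasSum_fderiv_iter hreg hbdd hs y)) x

theorem IsSmoothing.isMildSolution_tsum_iter (hS : IsSmoothing S Q δ C) (hB : Measurable B)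
    (hBK : ∀ x, ‖B x‖ ≤ K) (T : ℝ) :
    IsMildSolution S Q B u₀ T fun t x => ∑' n, iter S Q B u₀ n t x := by
  have hu := isRegular_tsum_iter hreg hbdd
  have hwi (c t : ℝ) : IntervalIntegrable (fun s => c * weight δ l s) volume 0 t :=
    (intervalIntegrable_weight hS.exponent_lt_one l 0 t).const_mul _
  have hbd : ∀ T, ∃ M : ℝ, ∀ t ∈ Icc 0 T, ∀ x, |∑' n, iter S Q B u₀ n t x| ≤ M := by
    intro T
    obtain ⟨c, hc⟩ := hbdd T
    refine ⟨∑' n : ℕ, c * (1 / 2) ^ n * 1, fun t ht x => ?_⟩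
    rw [← Real.norm_eq_abs]
    refine tsum_of_norm_bounded (summable_geometric_mul c 1).hasSum fun n => ?_
    simpa using hc n t ht x
  refine ⟨fun x => ?_, hbd T, fun t ht => ?_, ?_, fun t ht x => ?_, fun t ht x => ?_⟩
  · rw [tsum_eq_single 0]
    · exact hS.ouSemigroup_zero x
    · intro n hn
      obtain ⟨k, rfl⟩ := Nat.exists_eq_succ_of_ne_zero hn
      simp [iter]
  · obtain ⟨M, hM⟩ := hbd t
    exact ⟨hu.differentiable ht.1, ⟨M, hM t ⟨ht.1.le, le_rfl⟩⟩, _, hu.norm_fderiv_le t ht.1⟩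
  · refine hu.integrableOn_supNormD ?_
    rcases le_total 0 T with h | h
    · exact (intervalIntegrable_iff_integrableOn_Ioc_of_le h).1 (hwi _ T)
    · simp [Ioc_eq_empty_of_le h]
  · exact (intervalIntegrable_iff_integrableOn_Ioo_of_le ht.1.le).2
      (hS.integrableOn_mildIntegrand hB hBK hu
        ((intervalIntegrable_iff_integrableOn_Ioo_of_le ht.1.le).1 (hwi _ t)) x)
  -- Split off `v⁰ = S_t u₀`. The remaining terms are by definition the integrals of the drift terms
  -- of `vⁿ`, and dominated convergence exchanges sum and integral.
  · refine (summable_iter hbdd ht.1.le x).hasSum.unique (HasSum.zero_add ?_)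
    refine intervalIntegral.hasSum_integral_of_dominated_convergence
      (fun n s => K * (A * (1 / 2) ^ n * weight δ l s)) (fun n => ?_) (fun n => ?_) ?_ ?_ ?_
    · rw [uIoc_of_le ht.1.le, ← restrict_Ioo_eq_restrict_Ioc]
      exact hS.aestronglyMeasurable_mildIntegrand hB (hreg n) t x
    · refine Eventually.of_forall fun s hs => ?_
      rw [uIoc_of_le ht.1.le] at hs
      exact hS.abs_mildIntegrand_le hBK (hreg n) t x hs.1
    · exact Eventually.of_forall fun s _ => (summable_geometric_mul A (weight δ l s)).mul_left K
    · simp only [tsum_mul_left, tsum_geometric_mul]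
      exact (hwi _ t).const_mul K
    · refine Eventually.of_forall fun s hs => ?_
      rw [uIoc_of_le ht.1.le] at hs
      exact hS.hasSum_mildIntegrand_iter hreg hbdd hB hBK t hs.1 x

end Sum

end Iteration

/-! ### Singular Volterra inequalities -/

/-- The Volterra operator with kernel `k`; the kernels of interest vanish on the negative axis. -/
noncomputable def volterra (k : ℝ → ℝ≥0∞) (T : ℝ) (b : ℝ → ℝ≥0∞) (t : ℝ) : ℝ≥0∞ :=
  ∫⁻ s in Ioc 0 T, k (t - s) * b s

theorem measurable_volterra {k b : ℝ → ℝ≥0∞} (hk : Measurable k) (hb : Measurable b) (T : ℝ) :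
    Measurable (volterra k T b) :=
  Measurable.lintegral_prod_right' (f := fun p : ℝ × ℝ => k (p.1 - p.2) * b p.2)
    ((hk.comp (by fun_prop)).mul (hb.comp (by fun_prop)))

/-- Young's inequality in `L¹`: the factorization `e^{-lt} = e^{-ls} e^{-l(t-s)}` distributes the
weight over the two factors of the convolution. -/
theorem lintegral_exp_mul_volterra_le {k b : ℝ → ℝ≥0∞} (hk : Measurable k) (hb : Measurable b)
    (T l : ℝ) :
    ∫⁻ t in Ioc 0 T, ENNReal.ofReal (Real.exp (-(l * t))) * volterra k T b t ≤
      (∫⁻ r, k r * ENNReal.ofReal (Real.exp (-(l * r)))) *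
        ∫⁻ s in Ioc 0 T, ENNReal.ofReal (Real.exp (-(l * s))) * b s := by
  set E : ℝ → ℝ≥0∞ := fun t => ENNReal.ofReal (Real.exp (-(l * t))) with hE
  have hEm : Measurable E := by fun_prop
  have hadd (t s : ℝ) : E t = E s * E (t - s) := by
    rw [hE, ← ENNReal.ofReal_mul (Real.exp_nonneg _), ← Real.exp_add]; ring_nf
  calc ∫⁻ t in Ioc 0 T, E t * volterra k T b t
      = ∫⁻ t in Ioc 0 T, ∫⁻ s in Ioc 0 T, E t * (k (t - s) * b s) := by
        refine lintegral_congr fun t => ?_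
        rw [volterra, lintegral_const_mul _ (by fun_prop)]
    _ = ∫⁻ s in Ioc 0 T, ∫⁻ t in Ioc 0 T, E t * (k (t - s) * b s) :=
        lintegral_lintegral_swap (Measurable.aemeasurable (by unfold Function.uncurry; fun_prop))
    _ ≤ ∫⁻ s in Ioc 0 T, (∫⁻ r, k r * E r) * (E s * b s) := by
        refine lintegral_mono fun s => ?_
        calc ∫⁻ t in Ioc 0 T, E t * (k (t - s) * b s)
            ≤ ∫⁻ t, E t * (k (t - s) * b s) := setLIntegral_le_lintegral _ _
          _ = ∫⁻ t, (fun r => k r * E r) (t - s) * (E s * b s) := by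
              refine lintegral_congr fun t => ?_
              rw [hadd t s]; ring
          _ = (∫⁻ r, k r * E r) * (E s * b s) := by
              rw [lintegral_mul_const _ (by fun_prop),
                lintegral_sub_right_eq_self (fun r => k r * E r)]
    _ = _ := lintegral_const_mul _ (by fun_prop)

/-- A function dominated by the Volterra operator applied to each of its measurable majorants
vanishes, if the kernel is small in a weighted norm. -/
theorem ae_eq_zero_of_le_volterra {k N b : ℝ → ℝ≥0∞} (hk : Measurable k) (hb : Measurable b)
    {T l : ℝ} (hl : 0 ≤ l) (hkl : ∫⁻ r, k r * ENNReal.ofReal (Real.exp (-(l * r))) ≤ 2⁻¹)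
    (hbT : ∫⁻ s in Ioc 0 T, b s ≠ ∞) (hNb : ∀ᵐ s ∂volume.restrict (Ioc 0 T), N s ≤ b s)
    (hN : ∀ b : ℝ → ℝ≥0∞, Measurable b → (∀ᵐ s ∂volume.restrict (Ioc 0 T), N s ≤ b s) →
      ∀ t ∈ Ioc 0 T, N t ≤ volterra k T b t) :
    ∀ᵐ s ∂volume.restrict (Ioc 0 T), N s = 0 := by
  set E : ℝ → ℝ≥0∞ := fun t => ENNReal.ofReal (Real.exp (-(l * t))) with hE
  have hEm : Measurable E := by fun_prop
  -- `N` need not be measurable, so measurable majorants are iterated instead. Their weighted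
  -- integrals decay like `2^{-n}`, so their infimum vanishes almost everywhere.
  let f : ℕ → ℝ → ℝ≥0∞ := fun n => (volterra k T)^[n] b
  have hf : ∀ n, f (n + 1) = volterra k T (f n) := fun n => Function.iterate_succ_apply' _ _ _
  have hfm : ∀ n, Measurable (f n) := by
    intro n
    induction n with
    | zero => exact hb
    | succ n ih => rw [hf]; exact measurable_volterra hk ih T
  have hNf : ∀ n, ∀ᵐ s ∂volume.restrict (Ioc 0 T), N s ≤ f n s := by
    intro n
    induction n with
    | zero => exact hNb
    | succ n ih =>
      rw [hf]
      exact (ae_restrict_iff' measurableSet_Ioc).2 (Eventually.of_forall (hN _ (hfm n) ih))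
  set I : ℝ≥0∞ := ∫⁻ s in Ioc 0 T, E s * b s with hI
  have hIfin : I ≠ ∞ := by
    refine ne_top_of_le_ne_top hbT (setLIntegral_mono' measurableSet_Ioc fun s hs => ?_)
    refine mul_le_of_le_one_left zero_le (ENNReal.ofReal_le_one.2 ?_)
    exact Real.exp_le_one_iff.2 (by have := mul_nonneg hl hs.1.le; linarith)
  have hIf : ∀ n, ∫⁻ s in Ioc 0 T, E s * f n s ≤ 2⁻¹ ^ n * I := by
    intro n
    induction n with
    | zero => simp [f, hI]
    | succ n ih =>
      rw [hf, pow_succ', mul_assoc]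
      exact (lintegral_exp_mul_volterra_le hk (hfm n) T l).trans (mul_le_mul' hkl ih)
  have hzero : ∫⁻ s in Ioc 0 T, E s * ⨅ n, f n s = 0 := by
    have h1 : Tendsto (fun n : ℕ => (2⁻¹ : ℝ≥0∞) ^ n * I) atTop (𝓝 0) := by
      simpa using ENNReal.Tendsto.mul_const (b := I)
        (ENNReal.tendsto_pow_atTop_nhds_zero_of_lt_one (r := 2⁻¹) (by simp)) (Or.inr hIfin)
    refine le_antisymm (ge_of_tendsto' h1 fun n => le_trans ?_ (hIf n)) zero_le
    exact lintegral_mono fun s => mul_le_mul_right (iInf_le _ n) _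
  rw [lintegral_eq_zero_iff (by fun_prop)] at hzero
  filter_upwards [hzero, ae_all_iff.2 hNf] with s h1 h2
  have h3 : E s ≠ 0 := by simp [hE, Real.exp_pos]
  have h4 : ⨅ n, f n s = 0 := by simpa [h3] using h1
  exact le_antisymm (h4 ▸ le_iInf h2) zero_le

/-- The kernel `r ↦ c r^{-δ}`, extended by zero to the negative axis. -/
noncomputable def singularKernel (c δ r : ℝ) : ℝ≥0∞ :=
  (Ioi 0).indicator (fun r => ENNReal.ofReal (c * r ^ (-δ))) r

theorem measurable_singularKernel (c δ : ℝ) : Measurable (singularKernel c δ) :=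
  Measurable.indicator (by fun_prop) measurableSet_Ioi

theorem lintegral_singularKernel_mul_exp {c δ l : ℝ} (hc : 0 ≤ c) (hδ : δ < 1) (hl : 0 < l) :
    ∫⁻ r, singularKernel c δ r * ENNReal.ofReal (Real.exp (-(l * r))) =
      ENNReal.ofReal (c * ∫ r in Ioi (0 : ℝ), r ^ (-δ) * Real.exp (-(l * r))) := by
  rw [← integral_const_mul, ofReal_integral_eq_lintegral_ofReal
    ((integrableOn_rpow_mul_exp_neg hδ hl).const_mul c), ← lintegral_indicator measurableSet_Ioi]
  · refine lintegral_congr fun r => ?_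
    by_cases hr : r ∈ Ioi (0 : ℝ)
    · have : (0 : ℝ) < r := hr
      simp only [singularKernel, indicator_of_mem hr]
      rw [← ENNReal.ofReal_mul (by positivity), mul_assoc]
    · simp [singularKernel, indicator_of_notMem hr]
  · refine (ae_restrict_iff' measurableSet_Ioi).2 (Eventually.of_forall fun r hr => ?_)
    have : (0 : ℝ) < r := hr
    simp only [Pi.zero_apply]
    positivity

/-! ### Uniqueness of mild solutions -/

section Uniqueness

variable {H : Type*} [NormedAddCommGroup H] [InnerProductSpace ℝ H] {B : H → H}

theorem IsCb1.sub {f g : H → ℝ} (hf : IsCb1 f) (hg : IsCb1 g) : IsCb1 fun x => f x - g x := by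
  obtain ⟨h1, ⟨M1, h2⟩, M2, h3⟩ := hf
  obtain ⟨k1, ⟨L1, k2⟩, L2, k3⟩ := hg
  refine ⟨h1.sub k1, ⟨M1 + L1, fun x => (abs_sub _ _).trans (add_le_add (h2 x) (k2 x))⟩,
    M2 + L2, fun x => ?_⟩
  rw [fderiv_fun_sub (h1 x) (k1 x)]
  exact (norm_sub_le _ _).trans (add_le_add (h3 x) (k3 x))

theorem drift_sub {f g : H → ℝ} (hf : Differentiable ℝ f) (hg : Differentiable ℝ g) (x : H) :
    drift B (fun y => f y - g y) x = drift B f x - drift B g x := by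
  rw [drift, fderiv_fun_sub (hf x) (hg x)]; rfl

variable [CompleteSpace H] [SecondCountableTopology H] [MeasurableSpace H] [BorelSpace H]
  {S : C0Semigroup H} {Q : H →L[ℝ] H} {δ C K T : ℝ} {u₀ : H → ℝ} {u w : ℝ → H → ℝ}

/-- A competing solution is not assumed jointly measurable or `C¹`, so the integral is not
differentiated. Its increments in `x` are estimated instead, using that `S_{t-s}` sends bounded
drifts to Lipschitz functions, and the Lipschitz constant bounds the derivative. -/
theorem IsSmoothing.enorm_fderiv_sub_le (hS : IsSmoothing S Q δ C) (hB : Measurable B)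
    (hBK : ∀ x, ‖B x‖ ≤ K) (hu : IsMildSolution S Q B u₀ T u) (hw : IsMildSolution S Q B u₀ T w)
    {b : ℝ → ℝ≥0∞}
    (hb : ∀ᵐ s ∂volume.restrict (Ioc 0 T), ENNReal.ofReal (supNormD fun x => w s x - u s x) ≤ b s)
    {t : ℝ} (ht : t ∈ Ioc 0 T) :
    ENNReal.ofReal (supNormD fun x => w t x - u t x) ≤
      volterra (singularKernel (K * C) δ) T b t := by
  have hK : 0 ≤ K := (norm_nonneg _).trans (hBK 0)
  have hC := hS.const_pos
  have hcb : ∀ s ∈ Ioc 0 T, IsCb1 fun x => w s x - u s x :=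
    fun s hs => (hw.cb1 s hs).sub (hu.cb1 s hs)
  set V := volterra (singularKernel (K * C) δ) T b t with hV
  rcases eq_or_ne V ∞ with hVt | hVt
  · rw [hVt]; exact le_top
  have hsub : ∀ s ∈ Ioo 0 t, ∀ x, mildIntegrand S Q B w t x s - mildIntegrand S Q B u t x s =
      ouSemigroup S Q (t - s) (drift B fun y => w s y - u s y) x := by
    intro s hs x
    have hsT : s ∈ Ioc 0 T := ⟨hs.1, hs.2.le.trans ht.2⟩
    have h1 := hw.cb1 s hsT
    have h2 := hu.cb1 s hsT
    rw [show (drift B fun y => w s y - u s y) = fun y => drift B (w s) y - drift B (u s) y from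
      funext (drift_sub h1.1 h2.1)]
    exact (hS.ouSemigroup_sub _ (measurable_drift hB h1.1)
      (fun y => abs_drift_le hBK (norm_fderiv_le_supNormD h1 y)) (measurable_drift hB h2.1)
      (fun y => abs_drift_le hBK (norm_fderiv_le_supNormD h2 y)) x).symm
  -- Subtracting the four mild equations cancels the `u₀` terms. Linearity of `S_{t-s}` then leaves
  -- increments of the drift of `w - u`.
  have key : ∀ x y, ‖(w t x - u t x) - (w t y - u t y)‖ₑ ≤ V * ‖x - y‖ₑ := by
    intro x y
    have e : (w t x - u t x) - (w t y - u t y) = ∫ s in Ioc 0 t,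
        ((mildIntegrand S Q B w t x s - mildIntegrand S Q B u t x s) -
          (mildIntegrand S Q B w t y s - mildIntegrand S Q B u t y s)) := by
      have hi := fun z => hw.integrable_mild t ht z
      have hj := fun z => hu.integrable_mild t ht z
      rw [hw.mild t ht, hw.mild t ht, hu.mild t ht, hu.mild t ht,
        ← intervalIntegral.integral_of_le ht.1.le,
        intervalIntegral.integral_sub ((hi x).sub (hj x)) ((hi y).sub (hj y)),
        intervalIntegral.integral_sub (hi x) (hj x), intervalIntegral.integral_sub (hi y) (hj y)]
      ring
    rw [e, integral_Ioc_eq_integral_Ioo]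
    refine (enorm_integral_le_lintegral_enorm _).trans ?_
    have hbt : ∀ᵐ s ∂volume.restrict (Ioo 0 t),
        ENNReal.ofReal (supNormD fun x => w s x - u s x) ≤ b s :=
      ae_restrict_of_ae_restrict_of_subset
        (fun s hs => ⟨hs.1, hs.2.le.trans ht.2⟩ : Ioo 0 t ⊆ Ioc 0 T) hb
    calc _ ≤ ∫⁻ s in Ioo 0 t, singularKernel (K * C) δ (t - s) * b s * ‖x - y‖ₑ := by
          refine lintegral_mono_ae ?_
          filter_upwards [hbt, ae_restrict_mem measurableSet_Ioo] with s h1 hs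
          have hts : 0 < t - s := sub_pos.2 hs.2
          have hsc := hcb s ⟨hs.1, hs.2.le.trans ht.2⟩
          rw [hsub s hs, hsub s hs]
          refine le_trans ?_ (mul_le_mul_left (mul_le_mul_right h1 _) _)
          rw [singularKernel, indicator_of_mem (show t - s ∈ Ioi (0 : ℝ) from hts),
            ← ENNReal.ofReal_mul (by positivity), ← ofReal_norm, ← ofReal_norm,
            ← ENNReal.ofReal_mul (mul_nonneg (by positivity) (supNormD_nonneg _))]
          refine ENNReal.ofReal_le_ofReal ((hS.abs_ouSemigroup_sub_le hts
            (measurable_drift hB hsc.1)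
            (fun z => abs_drift_le hBK (norm_fderiv_le_supNormD hsc z)) x y).trans (le_of_eq ?_))
          rw [Real.rpow_neg hts.le]
          ring
      _ = (∫⁻ s in Ioo 0 t, singularKernel (K * C) δ (t - s) * b s) * ‖x - y‖ₑ :=
          lintegral_mul_const' _ _ enorm_ne_top
      _ ≤ _ := mul_le_mul_left (lintegral_mono_set
          (Ioo_subset_Ioc_self.trans (Ioc_subset_Ioc_right ht.2))) _
  have hlip : LipschitzWith V.toNNReal fun x => w t x - u t x := by
    intro x y
    rw [edist_eq_enorm_sub, edist_eq_enorm_sub, ENNReal.coe_toNNReal hVt]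
    exact key x y
  refine ENNReal.ofReal_le_of_le_toReal (supNormD_le fun x => ?_)
  exact norm_fderiv_le_of_lipschitz ℝ hlip

/-- Once `‖D(w-u)(s)‖_∞ = 0` for almost every `s`, the two drifts agree almost everywhere in time,
and the mild equation gives `w(t,x) = u(t,x)` for every `t` and `x`. -/
theorem IsSmoothing.isMildSolution_unique (hS : IsSmoothing S Q δ C) (hB : Measurable B)
    (hK : 0 < K) (hBK : ∀ x, ‖B x‖ ≤ K) (hu : IsMildSolution S Q B u₀ T u)
    (hw : IsMildSolution S Q B u₀ T w) {t : ℝ} (ht : t ∈ Icc 0 T) (x : H) : w t x = u t x := by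
  rcases ht.1.eq_or_lt with rfl | ht0
  · rw [hw.initial, hu.initial]
  have hC := hS.const_pos
  obtain ⟨l, hl, hle, -⟩ := exists_weight hS.exponent_pos hS.exponent_lt_one
    (ε := 1 / (2 * (K * C))) (by positivity)
  have hint := hw.integrable_supNormD.add hu.integrable_supNormD
  -- The measurable majorant that starts the iteration is a version of `‖Dw‖_∞ + ‖Du‖_∞`, which is
  -- integrable by hypothesis.
  obtain ⟨g, hg, hge⟩ := hint.aemeasurable
  have hzero := ae_eq_zero_of_le_volterra (k := singularKernel (K * C) δ)
    (N := fun s => ENNReal.ofReal (supNormD fun x => w s x - u s x))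
    (b := fun s => ‖g s‖ₑ) (measurable_singularKernel _ _) hg.enorm hl.le ?_
    (hint.congr hge).2.ne ?_
    (fun b _ hb t ht => hS.enorm_fderiv_sub_le hB hBK hu hw hb ht)
  · have hT : Ioc 0 t ⊆ Ioc 0 T := Ioc_subset_Ioc_right ht.2
    rw [hw.mild t ⟨ht0, ht.2⟩, hu.mild t ⟨ht0, ht.2⟩]
    congr 1
    rw [intervalIntegral.integral_of_le ht0.le, intervalIntegral.integral_of_le ht0.le]
    refine integral_congr_ae ?_
    filter_upwards [ae_restrict_of_ae_restrict_of_subset hT hzero,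
      ae_restrict_mem measurableSet_Ioc] with s h0 hs
    have h1 := hw.cb1 s (hT hs)
    have h2 := hu.cb1 s (hT hs)
    have h3 : supNormD (fun x => w s x - u s x) ≤ 0 := ENNReal.ofReal_eq_zero.1 h0
    have h4 : drift B (w s) = drift B (u s) := by
      funext y
      have := norm_le_zero_iff.1 ((norm_fderiv_le_supNormD (h1.sub h2) y).trans h3)
      rw [← sub_eq_zero, ← drift_sub h1.1 h2.1, drift, this]
      rfl
    rw [mildIntegrand, mildIntegrand, h4]
  · rw [lintegral_singularKernel_mul_exp (by positivity) hS.exponent_lt_one hl]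
    have : K * C * ∫ r in Ioi (0 : ℝ), r ^ (-δ) * Real.exp (-(l * r)) ≤ 2⁻¹ := by
      calc _ ≤ K * C * (1 / (2 * (K * C))) := by gcongr
        _ = 2⁻¹ := by field_simp
    refine (ENNReal.ofReal_le_ofReal this).trans ?_
    rw [ENNReal.ofReal_inv_of_pos two_pos]; simp
  · filter_upwards [hge, ae_restrict_mem measurableSet_Ioc] with s h1 hs
    rw [← h1, ← ofReal_norm]
    refine ENNReal.ofReal_le_ofReal (le_trans ?_ (le_abs_self _))
    have hw1 := hw.cb1 s hs
    have hu1 := hu.cb1 s hs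
    refine supNormD_le fun x => ?_
    rw [fderiv_fun_sub (hw1.1 x) (hu1.1 x)]
    exact (norm_sub_le _ _).trans
      (add_le_add (norm_fderiv_le_supNormD hw1 x) (norm_fderiv_le_supNormD hu1 x))

end Uniqueness

end MildKolmogorov

/-! ### The theorem -/

theorem mainTheorem2 {H : Type*} [NormedAddCommGroup H] [InnerProductSpace ℝ H] [CompleteSpace H]
    [SecondCountableTopology H] [MeasurableSpace H] [BorelSpace H]
    (A : H →ₗ.[ℝ] H) (S : C0Semigroup H) (hA : S.IsGenerator A)
    (Q : H →L[ℝ] H) (hQ : Q.IsPositive) (hQker : ∀ x, Q x = 0 → x = 0)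
    (htrace : ∀ t : ℝ, 0 < t → HasFiniteTrace (covOp S Q t))
    (hrange : ∀ t : ℝ, 0 < t → range (S.op t) ⊆ range (sqrtOp (covOp S Q t)))
    (δ C : ℝ) (hδ0 : 0 < δ) (hδ1 : δ < 1) (hC : 0 < C)
    (hLam : ∀ t : ℝ, 0 < t → ∀ h : H, ‖Lam S Q t h‖ ≤ C / t ^ δ * ‖h‖)
    (u₀ : H → ℝ) (hu₀ : Measurable u₀) (hu₀b : ∃ M : ℝ, ∀ x, |u₀ x| ≤ M)
    (B : H → H) (hB : Measurable B) (hBb : ∃ M : ℝ, ∀ x, ‖B x‖ ≤ M) :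
    -- every step of the iteration is well defined
    (∀ n : ℕ, ∀ t : ℝ, 0 < t → IsCb1 (iter S Q B u₀ n t) ∧
      ∀ x, IntervalIntegrable (mildIntegrand S Q B (iter S Q B u₀ n) t x) volume 0 t) ∧
    ∃ u : ℝ → H → ℝ,
      -- `u = ∑ vⁿ`, uniformly on every `[0,T] × H`
      (∀ T : ℝ, 0 < T → TendstoUniformlyOn
        (fun (N : ℕ) (p : ℝ × H) => ∑ n ∈ Finset.range N, iter S Q B u₀ n p.1 p.2)
        (fun p => u p.1 p.2) atTop (Icc 0 T ×ˢ univ)) ∧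
      -- the derivative is moreover continuous at positive times
      (∀ t : ℝ, 0 < t → ContDiff ℝ 1 (u t)) ∧
      -- `u` is a mild solution, and the only one
      ∀ T : ℝ, 0 < T → IsMildSolution S Q B u₀ T u ∧
        ∀ w : ℝ → H → ℝ, IsMildSolution S Q B u₀ T w → ∀ t ∈ Icc 0 T, ∀ x, w t x = u t x := by
  obtain ⟨M, hM⟩ := hu₀b
  obtain ⟨K₀, hK₀⟩ := hBb
  -- A strictly positive bound on `B`, as the choice of the weight divides by `K C`.
  have hK : 0 < max K₀ 1 := lt_max_of_lt_right one_pos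
  have hBK : ∀ x, ‖B x‖ ≤ max K₀ 1 := fun x => (hK₀ x).trans (le_max_left _ _)
  have hS : IsSmoothing S Q δ C := ⟨hQ, hQker, htrace, hrange, hδ0, hδ1, hC, hLam⟩
  obtain ⟨l, a, ha, hreg⟩ := hS.exists_isRegular_iter hB hK hBK hu₀ hM
  have hbdd := hS.exists_abs_iter_le hK.le hBK hM ha hreg
  refine ⟨fun n t ht => ⟨iter_isCb1 hreg hbdd n ht, fun x => ?_⟩,
    fun t x => ∑' n, iter S Q B u₀ n t x, fun T _ => tendstoUniformlyOn_iter hbdd T,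
    (isRegular_tsum_iter hreg hbdd).contDiff, fun T _ => ?_⟩
  · rw [intervalIntegrable_iff_integrableOn_Ioo_of_le ht.le]
    refine hS.integrableOn_mildIntegrand hB hBK (hreg n) ?_ x
    rw [← intervalIntegrable_iff_integrableOn_Ioo_of_le ht.le]
    exact (intervalIntegrable_weight hδ1 l 0 t).const_mul _
  · have hu := hS.isMildSolution_tsum_iter hreg hbdd hB hBK T
    exact ⟨hu, fun w hw t ht x => hS.isMildSolution_unique hB hK hBK hu hw ht x⟩
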